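/- Let $\Gamma$ be a totally ordered abelian group with positive cone $\Gamma^+=\{x\in\Gamma: x\ge 0\}$, let $\mathcal A$ be a unital $C^*$-algebra, and let $\alpha$ be an action of $\Gamma^+$ on $\mathcal A$ by (not necessarily unital) $*$-endomorphisms, $\alpha_0=\mathrm{Id}$, $\alpha_{x+y}=\alpha_x\circ\alpha_y$. Assume that $(\mathcal A,\Gamma^+,\alpha)$ is finely representable: there are a faithful non-degenerate representation $\pi:\mathcal A\to L(H)$ on a Hilbert space and a semigroup homomorphism $U:\Gamma^+\to L(H)$ with $\pi(\alpha_x(a))=U_x\pi(a)U_x^*$, $U_x^*\pi(a)U_x\in\pi(\mathcal A)$ and $U_x\pi(a)=\pi(\alpha_x(a))U_x$ for all $a\in\mathcal A$, $x\in\Gamma^+$. Let $L$ be the unique complete transfer action, i.e. the unique family of continuous positive linear maps $L_x:\mathcal A\to\mathcal A$ ($x\in\Gamma^+$) with $L_{x+y}=L_y\circ L_x$, $L_x(\alpha_x(a)b)=aL_x(b)$ and $\alpha_x(L_x(a))=\alpha_x(1)a\alpha_x(1)$. Let $l_1(\Gamma,\alpha,\mathcal A)$ be the unital Banach $*$-algebra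 of all families $(a_g)_{g\in\Gamma}$ in $\mathcal A$ with $a_x\in\mathcal A\alpha_x(1)$, $a_{-x}\in\alpha_x(1)\mathcal A$ for $x\ge 0$ and $\|(a_g)\|=\sum_g\|a_g\|<\infty$, with involution $(a^*)_g=(a_{-g})^*$ and the continuous bilinear multiplication given, for $x,y\ge 0$, by $$a\delta_x\cdot b\delta_y=a\alpha_x(b)\delta_{x+y},\qquad a\delta_{-x}\cdot b\delta_{-y}=\alpha_y(a)b\,\delta_{-x-y},$$ $$a\delta_x\cdot b\delta_{-y}=\begin{cases}a\alpha_{x-y}(b)\delta_{x-y},&x\ge y,\\ \alpha_{y-x}(a)b\,\delta_{x-y},&x<y,\end{cases}\qquad a\delta_{-x}\cdot b\delta_{y}=\begin{cases}L_x(ab)\delta_{y-x},&x\le y,\\ L_y(ab)\delta_{y-x},&x>y,\end{cases}$$ where $a\delta_g$ is the family with entry $a$ at $g$ and $0$ elsewhere. Let the crossed product $\mathcal A\rtimes_\alpha\Gamma$ be the enveloping $C^*$-algebra of $l_1(\Gamma,\alpha,\mathcal A)$, let $u_x\in\mathcal A\rtimes_\alpha\Gamma$ be the image of $\alpha_x(1)\delta_x$,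 and write $a$ also for the image of $a\delta_0$, $a\in\mathcal A$. Let $C_0\subset\mathcal A\rtimes_\alpha\Gamma$ be the set of all elements of the form $$a=\sum_{x\in F}u_x^*a_{-x}+a_0+\sum_{x\in F}a_xu_x,\qquad F\subset\Gamma^+\setminus\{0\}\text{ finite},\quad a_0\in\mathcal A,\ a_x\in\mathcal A\alpha_x(1),\ a_{-x}\in\alpha_x(1)\mathcal A\ (x\in F),$$ and let $E_0(a)=a_0\in\mathcal A$ for such $a$. **Theorem 5.7.** Let $a\in C_0$. Then every $(aa^*)^{2k}$, $k\ge 0$, lies in $C_0$ and its coefficient $E_0[(aa^*)^{2k}]$ is uniquely determined, and $$\|a\|=\lim_{k\to\infty}\bigl\|E_0[(a a^*)^{2k}]\bigr\|^{1/(4k)}.$$ -/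

import Mathlib

open Filter Topology

universe u v w

set_option linter.unusedSectionVars false

noncomputable section

/-- The positive cone `Γ⁺ = {x ∈ Γ : 0 ≤ x}` of an ordered abelian group. -/
abbrev PosCone (Γ : Type u) [AddCommGroup Γ] [LinearOrder Γ] : Type u := {x : Γ // 0 ≤ x}

/-- A C*-dynamical system `(A, Γ⁺, α)`: an action `α` of the positive cone of `Γ` on the unital
C*-algebra `A` by (not necessarily unital) *-endomorphisms. -/
structure EndoAction (Γ : Type u) [AddCommGroup Γ] [LinearOrder Γ] [IsOrderedAddMonoid Γ]
    (A : Type v) [CStarAlgebra A] where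
  toFun : PosCone Γ → (A →⋆ₙₐ[ℂ] A)
  map_zero : toFun 0 = NonUnitalStarAlgHom.id ℂ A
  map_add : ∀ x y, toFun (x + y) = (toFun x).comp (toFun y)

section

variable {Γ : Type u} [AddCommGroup Γ] [LinearOrder Γ] [IsOrderedAddMonoid Γ]
variable {A : Type v} [CStarAlgebra A]

instance : CoeFun (EndoAction Γ A) (fun _ => PosCone Γ → (A →⋆ₙₐ[ℂ] A)) := ⟨EndoAction.toFun⟩

/-- A complete transfer action `L` for `(A, Γ⁺, α)`: an action of `Γ⁺` by continuous linear
positive maps satisfying the transfer identity `L_x(α_x(a) b) = a L_x(b)` and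
the completeness identity `α_x(L_x(a)) = α_x(1) a α_x(1)`. (Positive elements of a C*-algebra
are the elements of the form `b* b`.) -/
structure IsCompleteTransferAction (α : EndoAction Γ A) (L : PosCone Γ → (A →L[ℂ] A)) :
    Prop where
  comp_add : ∀ x y, L (x + y) = (L y).comp (L x)
  positive : ∀ x a, ∃ b, L x (star a * a) = star b * b
  transfer : ∀ x a b, L x (α x a * b) = a * L x b
  complete : ∀ x a, α x (L x a) = α x 1 * a * α x 1

/-- A triple `(H, π, U)`: a faithful non-degenerate (that is, unital) representation `π` of `A` on
a Hilbert space `H` and a semigroup homomorphism `U : Γ⁺ → L(H)`, with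
`π(α_x(a)) = U_x π(a) U_x*`, `U_x* π(a) U_x ∈ π(A)` and `U_x π(a) = π(α_x(a)) U_x`.
(`U_0 = 1` follows from these conditions.) -/
structure FineRepresentation (α : EndoAction Γ A) (H : Type w) [NormedAddCommGroup H]
    [InnerProductSpace ℂ H] [CompleteSpace H] where
  π : A →⋆ₐ[ℂ] (H →L[ℂ] H)
  U : PosCone Γ → (H →L[ℂ] H)
  faithful : Function.Injective π
  U_add : ∀ x y, U (x + y) = U x * U y
  map_alpha : ∀ x a, π (α x a) = U x * π a * star (U x)
  mem_range : ∀ x a, star (U x) * π a * U x ∈ Set.range π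
  intertwine : ∀ x a, U x * π a = π (α x a) * U x

/-- The C*-dynamical system `(A, Γ⁺, α)` is finely representable. -/
def FinelyRepresentable (α : EndoAction Γ A) : Prop :=
  ∃ (H : Type w) (_ : NormedAddCommGroup H) (_ : InnerProductSpace ℂ H) (_ : CompleteSpace H),
    Nonempty (FineRepresentation α H)

/-! ### The complete transfer action exists and is unique -/


theorem IsCompleteTransferAction.map_star {α : EndoAction Γ A} {L : PosCone Γ → (A →L[ℂ] A)}
    (hL : IsCompleteTransferAction α L) (x : PosCone Γ) (a : A) :
    L x (star a) = star (L x a) := by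
  have hs : ∀ c : A, star (L x (star c * c)) = L x (star c * c) := fun c => by
    obtain ⟨b, hb⟩ := hL.positive x c
    rw [hb]; simp
  have hI : (Complex.I * Complex.I) = -1 := Complex.I_mul_I
  have h1 : (4 : ℂ) • a = star (a + 1) * (a + 1)
      + Complex.I • (star (a + Complex.I • 1) * (a + Complex.I • 1))
      - star (a - 1) * (a - 1)
      - Complex.I • (star (a - Complex.I • 1) * (a - Complex.I • 1)) := by
    simp only [star_add, star_sub, star_one, star_smul, add_mul, mul_add, sub_mul, mul_sub,
      smul_mul_assoc, mul_smul_comm, mul_one, one_mul, smul_add, smul_sub, smul_smul,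
      RCLike.star_def, Complex.conj_I, neg_mul, hI, neg_smul, one_smul, smul_neg, neg_neg]
    module
  have h2 : (4 : ℂ) • star a = star (a + 1) * (a + 1)
      - Complex.I • (star (a + Complex.I • 1) * (a + Complex.I • 1))
      - star (a - 1) * (a - 1)
      + Complex.I • (star (a - Complex.I • 1) * (a - Complex.I • 1)) := by
    simp only [star_add, star_sub, star_one, star_smul, add_mul, mul_add, sub_mul, mul_sub,
      smul_mul_assoc, mul_smul_comm, mul_one, one_mul, smul_add, smul_sub, smul_smul,
      RCLike.star_def, Complex.conj_I, neg_mul, hI, neg_smul, one_smul, smul_neg, neg_neg]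
    module
  have s0 := hs (a + 1)
  have s1 := hs (a + Complex.I • 1)
  have s2 := hs (a - 1)
  have s3 := hs (a - Complex.I • 1)
  generalize star (a + 1) * (a + 1) = p0 at *
  generalize star (a + Complex.I • 1) * (a + Complex.I • 1) = p1 at *
  generalize star (a - 1) * (a - 1) = p2 at *
  generalize star (a - Complex.I • 1) * (a - Complex.I • 1) = p3 at *
  have h3 := congrArg (fun c => star (L x c)) h1
  have h4 := congrArg (L x) h2
  simp only [map_add, map_sub, map_smul, star_add, star_sub, star_smul, s0, s1, s2, s3,
    RCLike.star_def, Complex.conj_I, neg_smul, Complex.conj_ofNat] at h3 h4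
  have h5 : (4 : ℂ) • L x (star a) = (4 : ℂ) • star (L x a) := by
    rw [h4, h3]; abel
  exact smul_right_injective A (by norm_num : (4 : ℂ) ≠ 0) h5

theorem IsCompleteTransferAction.transfer_right {α : EndoAction Γ A} {L : PosCone Γ → (A →L[ℂ] A)}
    (hL : IsCompleteTransferAction α L) (x : PosCone Γ) (a b : A) :
    L x (b * α x a) = L x b * a := by
  have h := congrArg star (hL.transfer x (star a) (star b))
  rwa [← hL.map_star, star_mul, star_mul, StarHomClass.map_star, star_star, star_star, star_star,
    hL.map_star, star_star] at h

theorem IsCompleteTransferAction.eq_mul {α : EndoAction Γ A} {L M : PosCone Γ → (A →L[ℂ] A)}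
    (hL : IsCompleteTransferAction α L) (hM : IsCompleteTransferAction α M) (x : PosCone Γ)
    (a : A) : L x a = M x a * L x 1 := by
  rw [← hL.transfer, mul_one, hM.complete, hL.transfer_right, hL.transfer, one_mul, mul_one]

theorem IsCompleteTransferAction.unique {α : EndoAction Γ A} {L M : PosCone Γ → (A →L[ℂ] A)}
    (hL : IsCompleteTransferAction α L) (hM : IsCompleteTransferAction α M) : L = M := by
  have h1 : ∀ x, L x 1 = M x 1 := fun x => by
    have e1 := hL.eq_mul hM x 1
    have e2 := congrArg star (hM.eq_mul hL x 1)
    rw [star_mul, ← hM.map_star, ← hL.map_star, star_one] at e2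
    rw [← e2] at e1; exact e1
  funext x
  ext a
  rw [hL.eq_mul hM, h1]
  exact (hM.eq_mul hM x a).symm

theorem FineRepresentation.exists_transfer {α : EndoAction Γ A} {H : Type w}
    [NormedAddCommGroup H] [InnerProductSpace ℂ H] [CompleteSpace H]
    (R : FineRepresentation α H) :
    ∃ L : PosCone Γ → (A →L[ℂ] A), IsCompleteTransferAction α L ∧
      ∀ x a, R.π (L x a) = star (R.U x) * R.π a * R.U x := by
  choose L hL using R.mem_range
  have hn : ∀ a, ‖R.π a‖ = ‖a‖ := NonUnitalStarAlgHom.norm_map R.π R.faithful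
  let L' : PosCone Γ → (A →L[ℂ] A) := fun x => LinearMap.mkContinuous
    { toFun := L x
      map_add' := fun a b => R.faithful (by simp only [map_add, hL, mul_add, add_mul])
      map_smul' := fun c a => R.faithful (by
        simp only [map_smul, hL, mul_smul_comm, smul_mul_assoc, RingHom.id_apply]) }
    (‖star (R.U x)‖ * ‖R.U x‖) (fun a => by
      change ‖L x a‖ ≤ _
      rw [← hn, hL, ← hn a]
      calc _ ≤ ‖star (R.U x) * R.π a‖ * ‖R.U x‖ := norm_mul_le _ _
        _ ≤ ‖star (R.U x)‖ * ‖R.π a‖ * ‖R.U x‖ := by gcongr; exact norm_mul_le _ _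
        _ = _ := by ring)
  have hL' : ∀ x a, R.π (L' x a) = star (R.U x) * R.π a * R.U x := hL
  have hUU : ∀ x, R.π (α x 1) = R.U x * star (R.U x) := fun x => by
    rw [R.map_alpha, map_one, mul_one]
  have hint : ∀ x a, R.π a * star (R.U x) = star (R.U x) * R.π (α x a) := fun x a => by
    have h := congrArg star (R.intertwine x (star a))
    rwa [star_mul, star_mul, ← StarHomClass.map_star, ← StarHomClass.map_star,
      ← StarHomClass.map_star, star_star] at h
  refine ⟨L', ⟨fun x y => ?_, fun x a => ?_, fun x a b => ?_, fun x a => ?_⟩, hL'⟩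
  · ext a
    apply R.faithful
    rw [ContinuousLinearMap.comp_apply, hL', hL', hL', R.U_add, star_mul]
    simp only [mul_assoc]
  · have hsa : IsSelfAdjoint (L' x (star a * a)) := by
      apply R.faithful
      rw [StarHomClass.map_star, hL', map_mul, StarHomClass.map_star]
      simp only [star_mul, star_star, mul_assoc]
    have e : R.π (L' x (star a * a)) = star (R.π a * R.U x) * (R.π a * R.U x) := by
      rw [hL', map_mul, StarHomClass.map_star, star_mul]; simp only [mul_assoc]
    have hs : SpectrumRestricts (R.π (L' x (star a * a))) ContinuousMap.realToNNReal := by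
      rw [e, SpectrumRestricts.nnreal_iff]; exact spectrum_star_mul_self_nonneg
    have hs' : SpectrumRestricts (L' x (star a * a)) ContinuousMap.realToNNReal := by
      rw [SpectrumRestricts.nnreal_iff_nnnorm hsa le_rfl]
      rw [SpectrumRestricts.nnreal_iff_nnnorm (hsa.map R.π) (le_refl _)] at hs
      have h0 := NonUnitalStarAlgHom.nnnorm_map R.π R.faithful
      rw [h0] at hs
      rw [← h0, map_sub]
      convert hs using 3
      rw [IsScalarTower.algebraMap_apply ℝ ℂ A, IsScalarTower.algebraMap_apply ℝ ℂ (H →L[ℂ] H)]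
      exact AlgHomClass.commutes R.π _
    let _ := CStarAlgebra.spectralOrder A
    let _ := CStarAlgebra.spectralOrderedRing A
    exact CStarAlgebra.nonneg_iff_eq_star_mul_self.mp
      (nonneg_iff_isSelfAdjoint_and_quasispectrumRestricts.mpr ⟨hsa, hs'⟩)
  · apply R.faithful
    rw [hL', map_mul, map_mul, hL', ← mul_assoc, ← hint]
    simp only [mul_assoc]
  · apply R.faithful
    rw [R.map_alpha, hL', map_mul, map_mul, hUU]
    simp only [mul_assoc]

theorem FinelyRepresentable.existsUnique_transfer {α : EndoAction Γ A}
    (h : FinelyRepresentable.{u, v, w} α) :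
    ∃! L : PosCone Γ → (A →L[ℂ] A), IsCompleteTransferAction α L := by
  obtain ⟨H, _, _, _, ⟨R⟩⟩ := h
  obtain ⟨L, hL, -⟩ := R.exists_transfer
  exact ⟨L, hL, fun M hM => hM.unique hL⟩

/-- The unique complete transfer action `L` of a finely representable system. -/
def FinelyRepresentable.transfer {α : EndoAction Γ A} (h : FinelyRepresentable.{u, v, w} α) :
    PosCone Γ → (A →L[ℂ] A) := h.existsUnique_transfer.choose

theorem FinelyRepresentable.isCompleteTransferAction {α : EndoAction Γ A}
    (h : FinelyRepresentable.{u, v, w} α) : IsCompleteTransferAction α h.transfer :=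
  h.existsUnique_transfer.choose_spec.1

theorem FineRepresentation.map_transfer {α : EndoAction Γ A} (h : FinelyRepresentable.{u, v, w} α)
    {H : Type*} [NormedAddCommGroup H] [InnerProductSpace ℂ H] [CompleteSpace H]
    (R : FineRepresentation α H) (x : PosCone Γ) (a : A) :
    R.π (h.transfer x a) = star (R.U x) * R.π a * R.U x := by
  obtain ⟨L, hL, hL'⟩ := R.exists_transfer
  rw [h.isCompleteTransferAction.unique hL, hL']

/-! ### The Banach *-algebra `l₁(Γ, α, A)` -/

/-- `x ↦ x` for `x ≥ 0`, as an element of the positive cone (and `x ↦ 0` for `x ≤ 0`). -/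
def toCone (g : Γ) : PosCone Γ := ⟨max g 0, le_max_right g 0⟩

theorem toCone_of_nonpos {g : Γ} (hg : g ≤ 0) : toCone g = 0 := Subtype.ext (max_eq_right hg)

theorem toCone_coe (x : PosCone Γ) : toCone (x : Γ) = x := Subtype.ext (max_eq_left x.2)

theorem coe_toCone {g : Γ} (hg : 0 ≤ g) : (toCone g : Γ) = g := max_eq_left hg

theorem toCone_add {g k : Γ} (hg : 0 ≤ g) (hk : 0 ≤ k) :
    toCone (g + k) = toCone g + toCone k :=
  Subtype.ext (by simp [toCone, hg, hk, add_nonneg hg hk])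

theorem EndoAction.zero_apply (α : EndoAction Γ A) (a : A) : α 0 a = a := by
  rw [α.map_zero]; rfl

theorem EndoAction.add_apply (α : EndoAction Γ A) (x y : PosCone Γ) (a : A) :
    α (x + y) a = α x (α y a) := by
  rw [α.map_add]; rfl

/-- The condition on the `g`-th coefficient: `a_g ∈ A α_g(1)` if `g ≥ 0` and `a_g ∈ α_{-g}(1) A`
if `g ≤ 0`. -/
def IsCoeff (α : EndoAction Γ A) (g : Γ) (a : A) : Prop :=
  (0 ≤ g → ∃ b, a = b * α (toCone g) 1) ∧ (g ≤ 0 → ∃ b, a = α (toCone (-g)) 1 * b)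

theorem isCoeff_iff {α : EndoAction Γ A} {g : Γ} {a : A} :
    IsCoeff α g a ↔ a * α (toCone g) 1 = a ∧ α (toCone (-g)) 1 * a = a := by
  constructor
  · rintro ⟨h1, h2⟩
    constructor
    · rcases le_total 0 g with hg | hg
      · obtain ⟨b, rfl⟩ := h1 hg
        rw [mul_assoc, ← map_mul, one_mul]
      · rw [toCone_of_nonpos hg, α.zero_apply, mul_one]
    · rcases le_total 0 g with hg | hg
      · rw [toCone_of_nonpos (neg_nonpos.mpr hg), α.zero_apply, one_mul]
      · obtain ⟨b, rfl⟩ := h2 hg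
        rw [← mul_assoc, ← map_mul, one_mul]
  · rintro ⟨h1, h2⟩
    exact ⟨fun _ => ⟨a, h1.symm⟩, fun _ => ⟨a, h2.symm⟩⟩

theorem IsCoeff.star_mem {α : EndoAction Γ A} {g : Γ} {a : A} (ha : IsCoeff α g a) :
    IsCoeff α (-g) (star a) := by
  rw [isCoeff_iff] at ha ⊢
  have e : ∀ x, star (α x 1) = α x 1 := fun x => by rw [← StarHomClass.map_star, star_one]
  constructor
  · conv_rhs => rw [← ha.2]
    rw [star_mul, e]
  · conv_rhs => rw [← ha.1]
    rw [star_mul, e, neg_neg]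

theorem EndoAction.norm_apply_le (α : EndoAction Γ A) (x : PosCone Γ) (a : A) : ‖α x a‖ ≤ ‖a‖ :=
  NonUnitalStarAlgHom.norm_apply_le (α x) a

theorem EndoAction.continuous (α : EndoAction Γ A) (x : PosCone Γ) : Continuous (α x) :=
  AddMonoidHomClass.continuous_of_bound (α x) 1 (fun a => by simpa using α.norm_apply_le x a)

variable {α : EndoAction Γ A}

/-- The coefficient of the product `a δ_{g₁} · b δ_{g₂}`, which is concentrated at `g₁ + g₂`.
With `x, y > 0` in the mixed cases and `x, y ≥ 0` otherwise:
* `a δ_x · b δ_y = a α_x(b) δ_{x+y}` and `a δ_{-x} · b δ_{-y} = α_y(a) b δ_{-x-y}`;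
* `a δ_x · b δ_{-y}` is `a α_{x-y}(b) δ_{x-y}` if `x ≥ y` and `α_{y-x}(a) b δ_{x-y}` if `x < y`;
* `a δ_{-x} · b δ_y` is `L_x(a b) δ_{y-x}` if `x ≤ y` and `L_y(a b) δ_{y-x}` if `x > y`.
(On the overlaps with `g₁ = 0` or `g₂ = 0` the formulas agree.) -/
def coeffMul (h : FinelyRepresentable.{u, v, w} α) (g₁ g₂ : Γ) (a b : A) : A :=
  if 0 ≤ g₁ then
    if 0 ≤ g₂ then a * α (toCone g₁) b
    else if 0 ≤ g₁ + g₂ then a * α (toCone (g₁ + g₂)) b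
    else α (toCone (-(g₁ + g₂))) a * b
  else
    if g₂ ≤ 0 then α (toCone (-g₂)) a * b
    else if 0 ≤ g₁ + g₂ then h.transfer (toCone (-g₁)) (a * b)
    else h.transfer (toCone g₂) (a * b)

section CoeffMul

variable (h : FinelyRepresentable.{u, v, w} α)

theorem coeffMul_add_left (g₁ g₂ : Γ) (a a' b : A) :
    coeffMul h g₁ g₂ (a + a') b = coeffMul h g₁ g₂ a b + coeffMul h g₁ g₂ a' b := by
  unfold coeffMul; split_ifs <;> simp [add_mul]

theorem coeffMul_add_right (g₁ g₂ : Γ) (a b b' : A) :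
    coeffMul h g₁ g₂ a (b + b') = coeffMul h g₁ g₂ a b + coeffMul h g₁ g₂ a b' := by
  unfold coeffMul; split_ifs <;> simp [mul_add]

theorem coeffMul_smul_left (g₁ g₂ : Γ) (c : ℂ) (a b : A) :
    coeffMul h g₁ g₂ (c • a) b = c • coeffMul h g₁ g₂ a b := by
  unfold coeffMul; split_ifs <;> simp

theorem coeffMul_smul_right (g₁ g₂ : Γ) (c : ℂ) (a b : A) :
    coeffMul h g₁ g₂ a (c • b) = c • coeffMul h g₁ g₂ a b := by
  unfold coeffMul; split_ifs <;> simp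

theorem coeffMul_zero_left (g₁ g₂ : Γ) (b : A) : coeffMul h g₁ g₂ 0 b = 0 := by
  unfold coeffMul; split_ifs <;> simp

theorem coeffMul_zero_right (g₁ g₂ : Γ) (a : A) : coeffMul h g₁ g₂ a 0 = 0 := by
  unfold coeffMul; split_ifs <;> simp

theorem coeffMul_one_left {g : Γ} {b : A} (hb : IsCoeff α g b) : coeffMul h 0 g 1 b = b := by
  rw [isCoeff_iff] at hb
  unfold coeffMul
  rw [if_pos le_rfl, toCone_of_nonpos (le_refl (0 : Γ)), α.zero_apply, one_mul, zero_add]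
  split_ifs
  · rfl
  · exact hb.2

theorem coeffMul_one_right {g : Γ} {a : A} (ha : IsCoeff α g a) : coeffMul h g 0 a 1 = a := by
  rw [isCoeff_iff] at ha
  unfold coeffMul
  rw [if_pos le_rfl, if_pos le_rfl, neg_zero, toCone_of_nonpos (le_refl (0 : Γ)), α.zero_apply,
    mul_one]
  split_ifs
  · exact ha.1
  · rfl

theorem continuous_coeffMul_left (g₁ g₂ : Γ) (b : A) :
    Continuous fun a => coeffMul h g₁ g₂ a b := by
  have := α.continuous
  unfold coeffMul; split_ifs <;> fun_prop

theorem continuous_coeffMul_right (g₁ g₂ : Γ) (a : A) :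
    Continuous fun b => coeffMul h g₁ g₂ a b := by
  have := α.continuous
  unfold coeffMul; split_ifs <;> fun_prop

theorem IsCoeff.coeffMul {g₁ g₂ : Γ} {a b : A} (ha : IsCoeff α g₁ a) (hb : IsCoeff α g₂ b) :
    IsCoeff α (g₁ + g₂) (coeffMul h g₁ g₂ a b) := by
  have hL := h.isCompleteTransferAction
  rw [isCoeff_iff] at ha hb ⊢
  obtain ⟨ha1, ha2⟩ := ha
  obtain ⟨hb1, hb2⟩ := hb
  rcases le_or_gt 0 (g₁ + g₂) with hg | hg
  · rw [toCone_of_nonpos (neg_nonpos.mpr hg), α.zero_apply, one_mul]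
    refine ⟨?_, rfl⟩
    unfold _root_.coeffMul
    split_ifs with h1 h2 h2
    · rw [toCone_add h1 h2, α.add_apply, mul_assoc, ← map_mul, hb1]
    · rw [mul_assoc, ← map_mul, mul_one]
    · exact absurd hg (not_le.mpr (add_neg_of_neg_of_nonpos (not_le.mp h1) h2))
    · have e : toCone g₂ = toCone (-g₁) + toCone (g₁ + g₂) := by
        rw [← toCone_add (neg_nonneg.mpr (not_le.mp h1).le) hg]; simp
      rw [← hL.transfer_right, ← α.add_apply, ← e, mul_assoc, hb1]
  · rw [toCone_of_nonpos hg.le, α.zero_apply, mul_one]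
    refine ⟨rfl, ?_⟩
    unfold _root_.coeffMul
    split_ifs with h1 h2 h3 h2 h3
    · exact absurd (add_nonneg h1 h2) (not_le.mpr hg)
    · exact absurd h3 (not_le.mpr hg)
    · rw [← mul_assoc, ← map_mul, one_mul]
    · have e : toCone (-(g₁ + g₂)) = toCone (-g₂) + toCone (-g₁) := by
        rw [← toCone_add (neg_nonneg.mpr h2) (neg_nonneg.mpr (not_le.mp h1).le), neg_add, add_comm]
      rw [e, α.add_apply, ← mul_assoc, ← map_mul, ha2]
    · exact absurd h3 (not_le.mpr hg)
    · have e : toCone (-g₁) = toCone g₂ + toCone (-(g₁ + g₂)) := by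
        rw [← toCone_add (not_le.mp h2).le (neg_nonneg.mpr hg.le)]; simp
      rw [← hL.transfer, ← α.add_apply, ← e, ← mul_assoc, ha2]

/-- `a δ_g ↦ a U_g` for `g ≥ 0` and `a δ_g ↦ U_{-g}* a` for `g ≤ 0`. -/
def FineRepresentation.monomial {H : Type w} [NormedAddCommGroup H] [InnerProductSpace ℂ H]
    [CompleteSpace H] (R : FineRepresentation α H) (g : Γ) (a : A) : H →L[ℂ] H :=
  star (R.U (toCone (-g))) * R.π a * R.U (toCone g)

section Monomial

variable {H : Type w} [NormedAddCommGroup H] [InnerProductSpace ℂ H] [CompleteSpace H]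
  (R : FineRepresentation α H)

theorem FineRepresentation.U_mul_star (x : PosCone Γ) :
    R.U x * star (R.U x) = R.π (α x 1) := by
  rw [R.map_alpha, map_one, mul_one]

theorem FineRepresentation.U_zero : R.U 0 = 1 := by
  have h1 : R.U 0 * star (R.U 0) = 1 := by rw [R.U_mul_star, α.zero_apply, map_one]
  have h2 : R.U 0 * R.U 0 = R.U 0 := by rw [← R.U_add, add_zero]
  calc R.U 0 = R.U 0 * (R.U 0 * star (R.U 0)) := by rw [h1, mul_one]
    _ = 1 := by rw [← mul_assoc, h2, h1]

theorem FineRepresentation.intertwine_star (x : PosCone Γ) (a : A) :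
    R.π a * star (R.U x) = star (R.U x) * R.π (α x a) := by
  have h := congrArg star (R.intertwine x (star a))
  rwa [star_mul, star_mul, ← StarHomClass.map_star, ← StarHomClass.map_star,
      ← StarHomClass.map_star, star_star] at h

theorem FineRepresentation.monomial_of_nonneg {g : Γ} (hg : 0 ≤ g) (a : A) :
    R.monomial g a = R.π a * R.U (toCone g) := by
  rw [FineRepresentation.monomial, toCone_of_nonpos (neg_nonpos.mpr hg), R.U_zero, star_one,
    one_mul]

theorem FineRepresentation.monomial_of_nonpos {g : Γ} (hg : g ≤ 0) (a : A) :
    R.monomial g a = star (R.U (toCone (-g))) * R.π a := by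
  rw [FineRepresentation.monomial, toCone_of_nonpos hg, R.U_zero, mul_one]

theorem FineRepresentation.monomial_star (g : Γ) (a : A) :
    R.monomial (-g) (star a) = star (R.monomial g a) := by
  simp only [FineRepresentation.monomial, star_mul, star_star, neg_neg, StarHomClass.map_star,
    mul_assoc]

theorem FineRepresentation.monomial_sub (g : Γ) (a b : A) :
    R.monomial g (a - b) = R.monomial g a - R.monomial g b := by
  simp only [FineRepresentation.monomial, map_sub, mul_sub, sub_mul]

theorem FineRepresentation.norm_monomial {g : Γ} {a : A} (ha : IsCoeff α g a) :
    ‖R.monomial g a‖ = ‖a‖ := by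
  have hn : ∀ a, ‖R.π a‖ = ‖a‖ := NonUnitalStarAlgHom.norm_map R.π R.faithful
  rw [isCoeff_iff] at ha
  rw [← mul_self_inj (norm_nonneg _) (norm_nonneg _)]
  rcases le_total 0 g with hg | hg
  · rw [← CStarRing.norm_self_mul_star, ← CStarRing.norm_self_mul_star,
      R.monomial_of_nonneg hg, star_mul, ← mul_assoc, mul_assoc (R.π a), R.U_mul_star, ← map_mul,
      ha.1, ← StarHomClass.map_star, ← map_mul, hn]
  · rw [← CStarRing.norm_star_mul_self, ← CStarRing.norm_star_mul_self,
      R.monomial_of_nonpos hg, star_mul, star_star, mul_assoc, ← mul_assoc (R.U _), R.U_mul_star,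
      ← map_mul, ha.2, ← StarHomClass.map_star, ← map_mul, hn]

theorem FineRepresentation.monomial_mul {g₁ g₂ : Γ} {a b : A} (ha : IsCoeff α g₁ a)
    (hb : IsCoeff α g₂ b) :
    R.monomial g₁ a * R.monomial g₂ b = R.monomial (g₁ + g₂) (coeffMul h g₁ g₂ a b) := by
  rw [isCoeff_iff] at ha hb
  obtain ⟨ha1, ha2⟩ := ha
  obtain ⟨hb1, hb2⟩ := hb
  rcases le_or_gt 0 g₁ with h1 | h1
  · rcases le_or_gt 0 g₂ with h2 | h2
    · rw [coeffMul, if_pos h1, if_pos h2, R.monomial_of_nonneg h1, R.monomial_of_nonneg h2,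
        R.monomial_of_nonneg (add_nonneg h1 h2), toCone_add h1 h2, R.U_add, map_mul]
      simp only [mul_assoc]
      rw [← mul_assoc (R.U _) (R.π b), R.intertwine, mul_assoc]
    · rcases le_or_gt 0 (g₁ + g₂) with h3 | h3
      · have e : toCone g₁ = toCone (g₁ + g₂) + toCone (-g₂) := by
          rw [← toCone_add h3 (neg_nonneg.mpr h2.le)]; simp
        rw [coeffMul, if_pos h1, if_neg (not_le.mpr h2), if_pos h3, R.monomial_of_nonneg h1,
          R.monomial_of_nonpos h2.le, R.monomial_of_nonneg h3, e, R.U_add, map_mul]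
        simp only [mul_assoc]
        rw [← mul_assoc (R.U (toCone (-g₂))), R.U_mul_star, ← map_mul, hb2, R.intertwine]
      · have e : toCone (-g₂) = toCone g₁ + toCone (-(g₁ + g₂)) := by
          rw [← toCone_add h1 (neg_nonneg.mpr h3.le)]; simp
        rw [coeffMul, if_pos h1, if_neg (not_le.mpr h2), if_neg (not_le.mpr h3),
          R.monomial_of_nonneg h1, R.monomial_of_nonpos h2.le, R.monomial_of_nonpos h3.le, e,
          add_comm, R.U_add, star_mul, map_mul, ← mul_assoc (star _), ← R.intertwine_star,
          mul_assoc, mul_assoc, ← mul_assoc (R.U _), R.U_mul_star, ← mul_assoc, ← mul_assoc,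
          ← map_mul, ha1, mul_assoc]
  · rcases le_or_gt g₂ 0 with h2 | h2
    · have e : toCone (-(g₁ + g₂)) = toCone (-g₂) + toCone (-g₁) := by
        rw [← toCone_add (neg_nonneg.mpr h2) (neg_nonneg.mpr h1.le), neg_add, add_comm]
      rw [coeffMul, if_neg (not_le.mpr h1), if_pos h2, R.monomial_of_nonpos h1.le,
        R.monomial_of_nonpos h2, R.monomial_of_nonpos (add_neg_of_neg_of_nonpos h1 h2).le, e,
        R.U_add, star_mul, map_mul]
      simp only [mul_assoc]
      rw [← mul_assoc (R.π a), R.intertwine_star, mul_assoc]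
    · rcases le_or_gt 0 (g₁ + g₂) with h3 | h3
      · have e : toCone g₂ = toCone (-g₁) + toCone (g₁ + g₂) := by
          rw [← toCone_add (neg_nonneg.mpr h1.le) h3]; simp
        rw [coeffMul, if_neg (not_le.mpr h1), if_neg (not_le.mpr h2), if_pos h3,
          R.monomial_of_nonpos h1.le, R.monomial_of_nonneg h2.le, R.monomial_of_nonneg h3, e,
          R.U_add, R.map_transfer, map_mul]
        simp only [mul_assoc]
      · have e : toCone (-g₁) = toCone g₂ + toCone (-(g₁ + g₂)) := by
          rw [← toCone_add h2.le (neg_nonneg.mpr h3.le)]; simp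
        rw [coeffMul, if_neg (not_le.mpr h1), if_neg (not_le.mpr h2), if_neg (not_le.mpr h3),
          R.monomial_of_nonpos h1.le, R.monomial_of_nonneg h2.le, R.monomial_of_nonpos h3.le, e,
          R.U_add, star_mul, R.map_transfer, map_mul]
        simp only [mul_assoc]

theorem FineRepresentation.eq_of_monomial_eq {g : Γ} {a b : A} (ha : IsCoeff α g a)
    (hb : IsCoeff α g b) (hab : R.monomial g a = R.monomial g b) : a = b := by
  have hc : IsCoeff α g (a - b) := by
    rw [isCoeff_iff] at ha hb ⊢
    exact ⟨by rw [sub_mul, ha.1, hb.1], by rw [mul_sub, ha.2, hb.2]⟩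
  rw [← sub_eq_zero, ← norm_eq_zero, ← R.norm_monomial hc, R.monomial_sub, hab, sub_self,
    norm_zero]

end Monomial

theorem norm_coeffMul_le {g₁ g₂ : Γ} {a b : A} (ha : IsCoeff α g₁ a) (hb : IsCoeff α g₂ b) :
    ‖coeffMul h g₁ g₂ a b‖ ≤ ‖a‖ * ‖b‖ := by
  obtain ⟨H, _, _, _, ⟨R⟩⟩ := id h
  rw [← R.norm_monomial (ha.coeffMul h hb), ← R.monomial_mul h ha hb, ← R.norm_monomial ha,
    ← R.norm_monomial hb]
  exact norm_mul_le _ _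

theorem coeffMul_assoc {g₁ g₂ g₃ : Γ} {a b c : A} (ha : IsCoeff α g₁ a) (hb : IsCoeff α g₂ b)
    (hc : IsCoeff α g₃ c) :
    coeffMul h (g₁ + g₂) g₃ (coeffMul h g₁ g₂ a b) c =
      coeffMul h g₁ (g₂ + g₃) a (coeffMul h g₂ g₃ b c) := by
  obtain ⟨H, _, _, _, ⟨R⟩⟩ := id h
  have h1 := (ha.coeffMul h hb).coeffMul h hc
  have h2 := ha.coeffMul h (hb.coeffMul h hc)
  rw [← add_assoc] at h2
  refine R.eq_of_monomial_eq h1 h2 ?_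
  rw [← R.monomial_mul h (ha.coeffMul h hb) hc, add_assoc,
    ← R.monomial_mul h ha (hb.coeffMul h hc), ← R.monomial_mul h ha hb, ← R.monomial_mul h hb hc,
    mul_assoc]

theorem star_coeffMul {g₁ g₂ : Γ} {a b : A} (ha : IsCoeff α g₁ a) (hb : IsCoeff α g₂ b) :
    star (coeffMul h g₁ g₂ a b) = coeffMul h (-g₂) (-g₁) (star b) (star a) := by
  obtain ⟨H, _, _, _, ⟨R⟩⟩ := id h
  have h1 := (ha.coeffMul h hb).star_mem
  have h2 := hb.star_mem.coeffMul h ha.star_mem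
  rw [← neg_add_rev] at h2
  refine R.eq_of_monomial_eq h1 h2 ?_
  rw [R.monomial_star, ← R.monomial_mul h ha hb, neg_add_rev,
    ← R.monomial_mul h hb.star_mem ha.star_mem, R.monomial_star, R.monomial_star, star_mul]

end CoeffMul

/-- The Banach space underlying `l₁(Γ, α, A)`: absolutely summable families `(a_g)`, `g ∈ Γ`, with
`a_x ∈ A α_x(1)` and `a_{-x} ∈ α_x(1) A` for `x ≥ 0`, with the norm `∑ ‖a_g‖`. -/
def l1Submodule (α : EndoAction Γ A) : Submodule ℂ (lp (fun _ : Γ => A) 1) where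
  carrier := {a | ∀ g, IsCoeff α g (a g)}
  add_mem' {a b} ha hb g := by
    have ha := isCoeff_iff.mp (ha g)
    have hb := isCoeff_iff.mp (hb g)
    refine isCoeff_iff.mpr ⟨?_, ?_⟩
    · rw [lp.coeFn_add, Pi.add_apply, add_mul, ha.1, hb.1]
    · rw [lp.coeFn_add, Pi.add_apply, mul_add, ha.2, hb.2]
  zero_mem' g := isCoeff_iff.mpr (by simp)
  smul_mem' c a ha g := by
    have ha := isCoeff_iff.mp (ha g)
    refine isCoeff_iff.mpr ⟨?_, ?_⟩
    · rw [lp.coeFn_smul, Pi.smul_apply, smul_mul_assoc, ha.1]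
    · rw [lp.coeFn_smul, Pi.smul_apply, mul_smul_comm, ha.2]

theorem isClosed_l1Submodule (α : EndoAction Γ A) :
    IsClosed (l1Submodule α : Set (lp (fun _ : Γ => A) 1)) := by
  have hc : ∀ g : Γ, Continuous fun a : lp (fun _ : Γ => A) 1 => (a g : A) := fun g =>
    (LipschitzWith.of_dist_le_mul (K := 1) (fun a b => by
      rw [dist_eq_norm, dist_eq_norm, NNReal.coe_one, one_mul]
      exact lp.norm_apply_le_norm one_ne_zero (a - b) g)).continuous
  have e : (l1Submodule α : Set (lp (fun _ : Γ => A) 1)) =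
      ⋂ g, {a | (a g : A) * α (toCone g) 1 = a g ∧ α (toCone (-g)) 1 * (a g : A) = a g} := by
    ext a
    simp only [Set.mem_iInter]
    exact forall_congr' fun g => isCoeff_iff
  rw [e]
  refine isClosed_iInter fun g => ?_
  exact (isClosed_eq ((hc g).mul continuous_const) (hc g)).inter
    (isClosed_eq (continuous_const.mul (hc g)) (hc g))

/-- The Banach *-algebra `l₁(Γ, α, A)` of a finely representable system. -/
def L1Algebra {α : EndoAction Γ A} (_h : FinelyRepresentable.{u, v, w} α) : Type (max u v) :=
  l1Submodule α

namespace L1Algebra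

variable (h : FinelyRepresentable.{u, v, w} α)

instance : NormedAddCommGroup (L1Algebra h) := inferInstanceAs (NormedAddCommGroup (l1Submodule α))

instance : NormedSpace ℂ (L1Algebra h) := inferInstanceAs (NormedSpace ℂ (l1Submodule α))

instance : CompleteSpace (L1Algebra h) :=
  (isClosed_l1Submodule α).completeSpace_coe

variable {h}

/-- The coefficient `a_g` of `a ∈ l₁(Γ, α, A)`. -/
def coeff (a : L1Algebra h) (g : Γ) : A := a.1 g

theorem isCoeff (a : L1Algebra h) (g : Γ) : IsCoeff α g (a.coeff g) := a.2 g

@[ext] theorem ext {a b : L1Algebra h} (hab : ∀ g, a.coeff g = b.coeff g) : a = b :=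
  Subtype.ext (lp.ext (funext hab))

@[simp] theorem coeff_add (a b : L1Algebra h) (g : Γ) : (a + b).coeff g = a.coeff g + b.coeff g :=
  rfl

@[simp] theorem coeff_zero (g : Γ) : (0 : L1Algebra h).coeff g = 0 := rfl

@[simp] theorem coeff_smul (c : ℂ) (a : L1Algebra h) (g : Γ) : (c • a).coeff g = c • a.coeff g :=
  rfl

theorem summable_norm (a : L1Algebra h) : Summable fun g => ‖a.coeff g‖ := by
  have h1 := (lp.memℓp a.1).summable (by simp)
  simp only [ENNReal.toReal_one, Real.rpow_one] at h1
  exact h1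

theorem norm_eq (a : L1Algebra h) : ‖a‖ = ∑' g, ‖a.coeff g‖ := by
  have h1 := lp.norm_eq_tsum_rpow (p := 1) (by simp) a.1
  simp only [ENNReal.toReal_one, Real.rpow_one, div_one] at h1
  exact h1

theorem norm_coeff_le (a : L1Algebra h) (g : Γ) : ‖a.coeff g‖ ≤ ‖a‖ := by
  rw [norm_eq]
  exact a.summable_norm.le_tsum g (fun _ _ => norm_nonneg _)

/-- The element of `l₁(Γ, α, A)` with the given coefficients. -/
def mk (f : Γ → A) (hf : ∀ g, IsCoeff α g (f g)) (hs : Summable fun g => ‖f g‖) : L1Algebra h :=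
  ⟨⟨f, memℓp_gen (by simpa using hs)⟩, hf⟩

@[simp] theorem coeff_mk (f : Γ → A) (hf : ∀ g, IsCoeff α g (f g)) (hs : Summable fun g => ‖f g‖)
    (g : Γ) : (mk f hf hs : L1Algebra h).coeff g = f g := rfl

/-- The element `a δ_g`. -/
def single (g : Γ) (a : A) (ha : IsCoeff α g a) : L1Algebra h :=
  ⟨lp.single (E := fun _ : Γ => A) 1 g a, fun k => by
    rw [lp.single_apply]
    rcases eq_or_ne k g with rfl | hk
    · rwa [Pi.single_eq_same]
    · rw [Pi.single_eq_of_ne hk]; exact isCoeff_iff.mpr (by simp)⟩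

theorem coeff_single (g k : Γ) (a : A) (ha : IsCoeff α g a) :
    (single g a ha : L1Algebra h).coeff k = if k = g then a else 0 := by
  change lp.single (E := fun _ : Γ => A) 1 g a k = _
  rw [lp.single_apply, Pi.single_apply]

/-- The terms of the convolution product, as a summable family over `Γ × Γ`. -/
theorem summable_terms (a b : L1Algebra h) :
    Summable fun p : Γ × Γ => ‖coeffMul h p.1 p.2 (a.coeff p.1) (b.coeff p.2)‖ :=
  Summable.of_nonneg_of_le (fun _ => norm_nonneg _)
    (fun p => norm_coeffMul_le h (a.isCoeff p.1) (b.isCoeff p.2))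
    (a.summable_norm.mul_of_nonneg b.summable_norm (fun _ => norm_nonneg _)
      (fun _ => norm_nonneg _))

/-- `(g, k) ↦ (k, g - k)`. -/
def convEquiv (Γ : Type u) [AddCommGroup Γ] : Γ × Γ ≃ Γ × Γ where
  toFun p := (p.2, p.1 - p.2)
  invFun p := (p.1 + p.2, p.1)
  left_inv p := by simp
  right_inv p := by simp

theorem summable_conv (a b : L1Algebra h) :
    Summable fun p : Γ × Γ => ‖coeffMul h p.2 (p.1 - p.2) (a.coeff p.2) (b.coeff (p.1 - p.2))‖ :=
  (convEquiv Γ).summable_iff.mpr (summable_terms a b)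

theorem summable_conv_fiber (a b : L1Algebra h) (g : Γ) :
    Summable fun k => coeffMul h k (g - k) (a.coeff k) (b.coeff (g - k)) :=
  ((summable_conv a b).prod_factor g).of_norm

theorem isCoeff_tsum {g : Γ} {f : Γ → A} (hf : ∀ k, IsCoeff α g (f k)) (hs : Summable f) :
    IsCoeff α g (∑' k, f k) := by
  rw [isCoeff_iff, ← hs.tsum_mul_right, ← hs.tsum_mul_left]
  exact ⟨tsum_congr fun k => (isCoeff_iff.mp (hf k)).1,
    tsum_congr fun k => (isCoeff_iff.mp (hf k)).2⟩

/-- The convolution product: `(a · b)_g` is the sum of the coefficients of `a_k δ_k · b_l δ_l` over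
all `k + l = g`. -/
instance : Mul (L1Algebra h) where
  mul a b := mk (fun g => ∑' k, coeffMul h k (g - k) (a.coeff k) (b.coeff (g - k)))
    (fun g => isCoeff_tsum (fun k => by
      have := (a.isCoeff k).coeffMul h (b.isCoeff (g - k))
      rwa [add_sub_cancel] at this) (summable_conv_fiber a b g))
    (Summable.of_nonneg_of_le (fun _ => norm_nonneg _)
      (fun g => norm_tsum_le_tsum_norm ((summable_conv a b).prod_factor g)) (summable_conv a b).prod)

theorem coeff_mul (a b : L1Algebra h) (g : Γ) :
    (a * b).coeff g = ∑' k, coeffMul h k (g - k) (a.coeff k) (b.coeff (g - k)) := rfl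

theorem isCoeff_one : IsCoeff α (0 : Γ) 1 := by
  rw [isCoeff_iff, neg_zero, toCone_of_nonpos (le_refl (0 : Γ)), α.zero_apply, mul_one]
  exact ⟨rfl, rfl⟩

instance : One (L1Algebra h) := ⟨single 0 1 isCoeff_one⟩

theorem coeff_one (g : Γ) : (1 : L1Algebra h).coeff g = if g = 0 then 1 else 0 :=
  coeff_single 0 g 1 isCoeff_one

/-- `(a*)_g = (a_{-g})*`. -/
instance : Star (L1Algebra h) where
  star a := mk (fun g => star (a.coeff (-g)))
    (fun g => by simpa using (a.isCoeff (-g)).star_mem)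
    (by
      simp only [norm_star]
      exact (Equiv.neg Γ).summable_iff.mpr a.summable_norm)

theorem coeff_star (a : L1Algebra h) (g : Γ) : (star a).coeff g = star (a.coeff (-g)) := rfl

protected theorem mul_add (a b c : L1Algebra h) : a * (b + c) = a * b + a * c := by
  ext g
  rw [coeff_add, coeff_mul, coeff_mul, coeff_mul,
    ← (summable_conv_fiber a b g).tsum_add (summable_conv_fiber a c g)]
  exact tsum_congr fun k => coeffMul_add_right h _ _ _ _ _

protected theorem add_mul (a b c : L1Algebra h) : (a + b) * c = a * c + b * c := by
  ext g
  rw [coeff_add, coeff_mul, coeff_mul, coeff_mul,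
    ← (summable_conv_fiber a c g).tsum_add (summable_conv_fiber b c g)]
  exact tsum_congr fun k => coeffMul_add_left h _ _ _ _ _

protected theorem one_mul (a : L1Algebra h) : 1 * a = a := by
  ext g
  rw [coeff_mul, tsum_eq_single 0]
  · rw [coeff_one, if_pos rfl, sub_zero, coeffMul_one_left h (a.isCoeff g)]
  · intro k hk
    rw [coeff_one, if_neg hk, coeffMul_zero_left]

protected theorem mul_one (a : L1Algebra h) : a * 1 = a := by
  ext g
  rw [coeff_mul, tsum_eq_single g]
  · rw [coeff_one, sub_self, if_pos rfl, coeffMul_one_right h (a.isCoeff g)]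
  · intro k hk
    rw [coeff_one, if_neg (sub_ne_zero.mpr hk.symm), coeffMul_zero_right]

protected theorem mul_assoc (a b c : L1Algebra h) : a * b * c = a * (b * c) := by
  ext g
  have hl : ∀ k l (d : A), ∀ f : Γ → A, Summable f →
      coeffMul h k l (∑' j, f j) d = ∑' j, coeffMul h k l (f j) d := fun k l d f hf =>
    ((hf.hasSum.map (AddMonoidHom.mk' (fun a => coeffMul h k l a d)
      (fun x y => coeffMul_add_left h k l x y d))
      (continuous_coeffMul_left h k l d)).tsum_eq).symm
  have hr : ∀ k l (d : A), ∀ f : Γ → A, Summable f →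
      coeffMul h k l d (∑' j, f j) = ∑' j, coeffMul h k l d (f j) := fun k l d f hf =>
    ((hf.hasSum.map (AddMonoidHom.mk' (fun a => coeffMul h k l d a)
      (fun x y => coeffMul_add_right h k l d x y))
      (continuous_coeffMul_right h k l d)).tsum_eq).symm
  let F : Γ → Γ → A := fun m k => coeffMul h m (g - m)
    (coeffMul h k (m - k) (a.coeff k) (b.coeff (m - k))) (c.coeff (g - m))
  have hco : ∀ m k, IsCoeff α m (coeffMul h k (m - k) (a.coeff k) (b.coeff (m - k))) := by
    intro m k
    have := (a.isCoeff k).coeffMul h (b.isCoeff (m - k))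
    rwa [add_sub_cancel] at this
  have hF : Summable (Function.uncurry F) := by
    refine Summable.of_norm_bounded ((summable_conv a b).mul_right ‖c‖) fun p => ?_
    refine (norm_coeffMul_le h (hco p.1 p.2) (c.isCoeff _)).trans ?_
    exact mul_le_mul_of_nonneg_left (c.norm_coeff_le _) (norm_nonneg _)
  have e1 : (a * b * c).coeff g = ∑' m, ∑' k, F m k := by
    rw [coeff_mul]
    refine tsum_congr fun m => ?_
    rw [coeff_mul, hl _ _ _ _ (summable_conv_fiber a b m)]
  have e2 : (a * (b * c)).coeff g = ∑' k, ∑' m, F m k := by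
    rw [coeff_mul]
    refine tsum_congr fun k => ?_
    rw [coeff_mul, hr _ _ _ _ (summable_conv_fiber b c _), ← (Equiv.subRight k).tsum_eq]
    refine tsum_congr fun m => ?_
    have := coeffMul_assoc h (a.isCoeff k) (b.isCoeff (m - k)) (c.isCoeff (g - m))
    rw [add_sub_cancel, add_comm (m - k), sub_add_sub_cancel] at this
    simp only [F, Equiv.subRight_apply, sub_sub_sub_cancel_right]
    rw [this]
  rw [e1, e2]
  exact hF.tsum_comm.symm

protected theorem norm_mul_le (a b : L1Algebra h) : ‖a * b‖ ≤ ‖a‖ * ‖b‖ := by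
  have h1 := summable_conv a b
  calc ‖a * b‖ = ∑' g, ‖(a * b).coeff g‖ := norm_eq _
    _ ≤ ∑' g, ∑' k, ‖coeffMul h k (g - k) (a.coeff k) (b.coeff (g - k))‖ :=
      (summable_norm _).tsum_le_tsum (fun g => norm_tsum_le_tsum_norm (h1.prod_factor g)) h1.prod
    _ = ∑' p : Γ × Γ, ‖coeffMul h p.2 (p.1 - p.2) (a.coeff p.2) (b.coeff (p.1 - p.2))‖ :=
      h1.tsum_prod.symm
    _ = ∑' p : Γ × Γ, ‖coeffMul h p.1 p.2 (a.coeff p.1) (b.coeff p.2)‖ :=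
      (convEquiv Γ).tsum_eq fun p => ‖coeffMul h p.1 p.2 (a.coeff p.1) (b.coeff p.2)‖
    _ ≤ ∑' p : Γ × Γ, ‖a.coeff p.1‖ * ‖b.coeff p.2‖ :=
      (summable_terms a b).tsum_le_tsum
        (fun p => norm_coeffMul_le h (a.isCoeff p.1) (b.isCoeff p.2))
        (a.summable_norm.mul_of_nonneg b.summable_norm (fun _ => norm_nonneg _)
          (fun _ => norm_nonneg _))
    _ = ‖a‖ * ‖b‖ := by
      rw [norm_eq, norm_eq]
      exact (a.summable_norm.tsum_mul_tsum b.summable_norm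
        (a.summable_norm.mul_of_nonneg b.summable_norm (fun _ => norm_nonneg _)
          (fun _ => norm_nonneg _))).symm

protected theorem star_mul (a b : L1Algebra h) : star (a * b) = star b * star a := by
  ext g
  rw [coeff_star, coeff_mul, coeff_mul, tsum_star]
  refine (tsum_congr fun k => ?_).trans ((Equiv.addLeft g).tsum_eq fun k =>
    coeffMul h k (g - k) ((star b).coeff k) ((star a).coeff (g - k)))
  rw [star_coeffMul h (a.isCoeff k) (b.isCoeff (-g - k)), coeff_star, coeff_star,
    Equiv.coe_addLeft]
  have e1 : -(-g - k) = g + k := by abel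
  have e2 : g - (g + k) = -k := by abel
  have e3 : -g - k = -(g + k) := by abel
  rw [e1, e2, e3, neg_neg]

instance : NormedRing (L1Algebra h) where
  __ := (inferInstance : NormedAddCommGroup (L1Algebra h))
  mul_assoc := L1Algebra.mul_assoc
  one_mul := L1Algebra.one_mul
  mul_one := L1Algebra.mul_one
  left_distrib := L1Algebra.mul_add
  right_distrib := L1Algebra.add_mul
  zero_mul a := by
    ext g
    rw [coeff_mul, coeff_zero]
    simp [coeffMul_zero_left]
  mul_zero a := by
    ext g
    rw [coeff_mul, coeff_zero]
    simp [coeffMul_zero_right]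
  norm_mul_le := L1Algebra.norm_mul_le

instance : NormedAlgebra ℂ (L1Algebra h) where
  __ := Algebra.ofModule (R := ℂ) (A := L1Algebra h)
    (fun c a b => by
      ext g
      rw [coeff_smul, coeff_mul, coeff_mul, ← (summable_conv_fiber a b g).tsum_const_smul c]
      exact tsum_congr fun k => coeffMul_smul_left h _ _ _ _ _)
    (fun c a b => by
      ext g
      rw [coeff_smul, coeff_mul, coeff_mul, ← (summable_conv_fiber a b g).tsum_const_smul c]
      exact tsum_congr fun k => coeffMul_smul_right h _ _ _ _ _)
  norm_smul_le c a := norm_smul_le c a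

instance : StarRing (L1Algebra h) where
  star_involutive a := by ext g; simp [coeff_star]
  star_mul := L1Algebra.star_mul
  star_add a b := by ext g; simp [coeff_star]

instance : StarModule ℂ (L1Algebra h) where
  star_smul c a := by ext g; simp [coeff_star]

instance : NormedStarGroup (L1Algebra h) where
  norm_star_le a := by
    rw [norm_eq, norm_eq]
    simp only [coeff_star, norm_star]
    exact ((Equiv.neg Γ).tsum_eq fun g => ‖a.coeff g‖).le

end L1Algebra

/-! ### The enveloping C*-algebra -/

/-- The C*-seminorm `‖a‖ = sup_ρ ‖ρ(a)‖`, where `ρ` runs through the non-degenerate (that is,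
unital) *-representations of `l₁(Γ, α, A)` on Hilbert spaces. Up to unitary equivalence all cyclic
representations occur in the universe used here. -/
def envelopingNorm (h : FinelyRepresentable.{u, v, w} α) (a : L1Algebra h) : ℝ :=
  sSup {r | ∃ (H : Type (max u v w)) (_ : NormedAddCommGroup H) (_ : InnerProductSpace ℂ H)
    (_ : CompleteSpace H) (ρ : L1Algebra h →⋆ₐ[ℂ] (H →L[ℂ] H)), r = ‖ρ a‖}

section Enveloping

variable {h : FinelyRepresentable.{u, v, w} α}

theorem L1Algebra.norm_rep_le {B : Type*} [CStarAlgebra B]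
    (ρ : L1Algebra h →⋆ₐ[ℂ] B) (a : L1Algebra h) : ‖ρ a‖ ≤ ‖a‖ := by
  rcases subsingleton_or_nontrivial A with hA | hA
  · have : a = 0 := L1Algebra.ext fun g => Subsingleton.elim _ _
    simp [this]
  · have : NormOneClass (L1Algebra h) := ⟨by
      rw [L1Algebra.norm_eq, tsum_eq_single 0]
      · rw [L1Algebra.coeff_one, if_pos rfl, CStarRing.norm_one]
      · intro k hk
        rw [L1Algebra.coeff_one, if_neg hk, norm_zero]⟩
    have key : ∀ b : L1Algebra h, IsSelfAdjoint b → ‖ρ b‖ ≤ ‖b‖ := fun b hb => by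
      have h1 : spectralRadius ℂ (ρ b) ≤ spectralRadius ℂ b :=
        iSup_le_iSup_of_subset (AlgHom.spectrum_apply_subset ρ b)
      rw [(hb.map ρ).spectralRadius_eq_nnnorm] at h1
      exact_mod_cast h1.trans (spectrum.spectralRadius_le_nnnorm b)
    refine (mul_self_le_mul_self_iff (norm_nonneg _) (norm_nonneg _)).mpr ?_
    rw [← CStarRing.norm_star_mul_self, ← StarHomClass.map_star, ← map_mul]
    refine (key _ (IsSelfAdjoint.star_mul_self a)).trans ((norm_mul_le _ _).trans ?_)
    rw [norm_star]

theorem envelopingNorm_bddAbove (a : L1Algebra h) :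
    BddAbove {r | ∃ (H : Type (max u v w)) (_ : NormedAddCommGroup H) (_ : InnerProductSpace ℂ H)
      (_ : CompleteSpace H) (ρ : L1Algebra h →⋆ₐ[ℂ] (H →L[ℂ] H)), r = ‖ρ a‖} := by
  refine ⟨‖a‖, ?_⟩
  rintro r ⟨H, _, _, _, ρ, rfl⟩
  exact L1Algebra.norm_rep_le ρ a

theorem norm_rep_le_envelopingNorm {H : Type (max u v w)} [NormedAddCommGroup H]
    [InnerProductSpace ℂ H] [CompleteSpace H] (ρ : L1Algebra h →⋆ₐ[ℂ] (H →L[ℂ] H))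
    (a : L1Algebra h) : ‖ρ a‖ ≤ envelopingNorm h a :=
  le_csSup (envelopingNorm_bddAbove a) ⟨H, _, _, _, ρ, rfl⟩

theorem envelopingNorm_nonneg (a : L1Algebra h) : 0 ≤ envelopingNorm h a := by
  refine Real.sSup_nonneg ?_
  rintro r ⟨H, _, _, _, ρ, rfl⟩
  exact norm_nonneg _

theorem envelopingNorm_le {a : L1Algebra h} {C : ℝ} (hC : 0 ≤ C)
    (hb : ∀ (H : Type (max u v w)) [NormedAddCommGroup H] [InnerProductSpace ℂ H]
      [CompleteSpace H] (ρ : L1Algebra h →⋆ₐ[ℂ] (H →L[ℂ] H)), ‖ρ a‖ ≤ C) :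
    envelopingNorm h a ≤ C := by
  refine Real.sSup_le ?_ hC
  rintro r ⟨H, _, _, _, ρ, rfl⟩
  exact hb H ρ

theorem envelopingNorm_congr {a b : L1Algebra h}
    (hab : ∀ (H : Type (max u v w)) [NormedAddCommGroup H] [InnerProductSpace ℂ H]
      [CompleteSpace H] (ρ : L1Algebra h →⋆ₐ[ℂ] (H →L[ℂ] H)), ‖ρ a‖ = ‖ρ b‖) :
    envelopingNorm h a = envelopingNorm h b :=
  le_antisymm
    (envelopingNorm_le (envelopingNorm_nonneg _) fun H _ _ _ ρ =>
      (hab H ρ).trans_le (norm_rep_le_envelopingNorm ρ b))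
    (envelopingNorm_le (envelopingNorm_nonneg _) fun H _ _ _ ρ =>
      (hab H ρ).symm.trans_le (norm_rep_le_envelopingNorm ρ a))

theorem envelopingNorm_star_mul_self (a : L1Algebra h) :
    envelopingNorm h (star a * a) = envelopingNorm h a * envelopingNorm h a := by
  have h0 := envelopingNorm_nonneg a
  apply le_antisymm
  · refine envelopingNorm_le (mul_self_nonneg _) fun H _ _ _ ρ => ?_
    have := norm_rep_le_envelopingNorm ρ a
    rw [map_mul, StarHomClass.map_star, CStarRing.norm_star_mul_self]
    gcongr
  · have h1 : envelopingNorm h a ≤ √(envelopingNorm h (star a * a)) :=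
      envelopingNorm_le (Real.sqrt_nonneg _) fun H _ _ _ ρ => by
        have := norm_rep_le_envelopingNorm ρ (star a * a)
        rw [map_mul, StarHomClass.map_star, CStarRing.norm_star_mul_self] at this
        exact Real.le_sqrt_of_sq_le (by rwa [sq])
    have h2 := (Real.le_sqrt h0 (envelopingNorm_nonneg _)).mp h1
    rwa [sq] at h2

/-- `l₁(Γ, α, A)` with its enveloping C*-seminorm. -/
def PreCrossedProduct (h : FinelyRepresentable.{u, v, w} α) : Type (max u v) := L1Algebra h

namespace PreCrossedProduct

instance : Ring (PreCrossedProduct h) := inferInstanceAs (Ring (L1Algebra h))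

instance : StarRing (PreCrossedProduct h) := inferInstanceAs (StarRing (L1Algebra h))

instance : Algebra ℂ (PreCrossedProduct h) := inferInstanceAs (Algebra ℂ (L1Algebra h))

instance : StarModule ℂ (PreCrossedProduct h) := inferInstanceAs (StarModule ℂ (L1Algebra h))

/-- The enveloping seminorm as a ring seminorm. -/
def ringSeminorm (h : FinelyRepresentable.{u, v, w} α) : RingSeminorm (PreCrossedProduct h) where
  toFun := envelopingNorm h
  map_zero' := le_antisymm
    (envelopingNorm_le le_rfl fun H _ _ _ ρ => by
      rw [show ρ (0 : PreCrossedProduct h) = 0 from map_zero ρ, norm_zero])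
    (envelopingNorm_nonneg _)
  add_le' a b := envelopingNorm_le (add_nonneg (envelopingNorm_nonneg _) (envelopingNorm_nonneg _))
    fun H _ _ _ ρ => by
      rw [show ρ (a + b) = ρ a + ρ b from map_add ρ _ _]
      exact (norm_add_le _ _).trans
        (add_le_add (norm_rep_le_envelopingNorm ρ a) (norm_rep_le_envelopingNorm ρ b))
  neg' a := envelopingNorm_congr fun H _ _ _ ρ => by
    rw [show ρ (-a) = -ρ a from map_neg ρ a, norm_neg]
  mul_le' a b := envelopingNorm_le (mul_nonneg (envelopingNorm_nonneg _) (envelopingNorm_nonneg _))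
    fun H _ _ _ ρ => by
      rw [show ρ (a * b) = ρ a * ρ b from map_mul ρ _ _]
      exact (norm_mul_le _ _).trans
        (mul_le_mul (norm_rep_le_envelopingNorm ρ a) (norm_rep_le_envelopingNorm ρ b)
          (norm_nonneg _) (envelopingNorm_nonneg _))

instance : SeminormedRing (PreCrossedProduct h) := (ringSeminorm h).toSeminormedRing

theorem norm_def (a : PreCrossedProduct h) : ‖a‖ = envelopingNorm h a := rfl

instance : NormedAlgebra ℂ (PreCrossedProduct h) where
  norm_smul_le c a := envelopingNorm_le (mul_nonneg (norm_nonneg _) (envelopingNorm_nonneg _))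
    fun H _ _ _ ρ => by
      rw [show ρ (c • a) = c • ρ a from map_smul ρ _ _, norm_smul]
      gcongr
      exact norm_rep_le_envelopingNorm ρ a

theorem norm_star_eq (a : PreCrossedProduct h) : ‖star a‖ = ‖a‖ :=
  envelopingNorm_congr fun H _ _ _ ρ => by
    exact (congrArg norm (StarHomClass.map_star ρ (show L1Algebra h from a))).trans (norm_star _)

instance : NormedStarGroup (PreCrossedProduct h) := ⟨fun a => (norm_star_eq a).le⟩

theorem norm_star_mul_self (a : PreCrossedProduct h) : ‖star a * a‖ = ‖a‖ * ‖a‖ :=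
  envelopingNorm_star_mul_self a

end PreCrossedProduct

/-- The crossed product `A ⋊_α Γ` of a finely representable system: the enveloping C*-algebra of
`l₁(Γ, α, A)`, that is, its (Hausdorff) completion in the enveloping C*-seminorm. -/
def CrossedProduct (h : FinelyRepresentable.{u, v, w} α) : Type (max u v) :=
  UniformSpace.Completion (PreCrossedProduct h)

namespace CrossedProduct

open UniformSpace

instance : NormedRing (CrossedProduct h) :=
  inferInstanceAs (NormedRing (Completion (PreCrossedProduct h)))

instance : CompleteSpace (CrossedProduct h) :=
  inferInstanceAs (CompleteSpace (Completion (PreCrossedProduct h)))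

instance : Algebra ℂ (CrossedProduct h) :=
  inferInstanceAs (Algebra ℂ (Completion (PreCrossedProduct h)))

instance : NormedAlgebra ℂ (CrossedProduct h) where
  norm_smul_le c a := norm_smul_le (β := Completion (PreCrossedProduct h)) c a

variable (h) in
/-- The canonical map `l₁(Γ, α, A) → A ⋊_α Γ`. -/
def ofL1 : L1Algebra h →ₐ[ℂ] CrossedProduct h where
  toFun a := ((show PreCrossedProduct h from a : PreCrossedProduct h) :
    Completion (PreCrossedProduct h))
  map_one' := rfl
  map_mul' a b := Completion.coe_mul (α := PreCrossedProduct h) a b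
  map_zero' := rfl
  map_add' a b := Completion.coe_add (α := PreCrossedProduct h) a b
  commutes' _ := rfl

theorem norm_ofL1 (a : L1Algebra h) : ‖ofL1 h a‖ = envelopingNorm h a :=
  Completion.norm_coe (E := PreCrossedProduct h) a

theorem denseRange_ofL1 : DenseRange (ofL1 h) :=
  Completion.denseRange_coe (α := PreCrossedProduct h)

instance : Star (CrossedProduct h) where
  star := Completion.map (fun a : PreCrossedProduct h => star a)

theorem continuous_star' : Continuous fun a : CrossedProduct h => star a :=
  Completion.continuous_map

theorem star_ofL1 (a : L1Algebra h) : star (ofL1 h a) = ofL1 h (star a) :=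
  Completion.map_coe (α := PreCrossedProduct h) (β := PreCrossedProduct h)
    (star_isometry (E := PreCrossedProduct h)).uniformContinuous a

theorem induction {p : CrossedProduct h → Prop} (hp : IsClosed {a | p a})
    (hb : ∀ b : L1Algebra h, p (ofL1 h b)) (a : CrossedProduct h) : p a :=
  denseRange_ofL1.induction_on a hp hb

instance : StarRing (CrossedProduct h) where
  star_involutive a := by
    have hc := continuous_star' (h := h)
    refine induction (isClosed_eq (hc.comp hc) continuous_id) (fun b => ?_) a
    change star (star (ofL1 h b)) = ofL1 h b
    rw [star_ofL1, star_ofL1, star_star]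
  star_mul a b := by
    have hc := continuous_star' (h := h)
    refine induction (p := fun a => star (a * b) = star b * star a)
      (isClosed_eq (by fun_prop) (by fun_prop)) (fun a => ?_) a
    refine induction (p := fun b => star (ofL1 h a * b) = star b * star (ofL1 h a))
      (isClosed_eq (by fun_prop) (by fun_prop)) (fun b => ?_) b
    rw [star_ofL1, star_ofL1, ← map_mul, ← map_mul, star_ofL1, star_mul]
  star_add a b := by
    have hc := continuous_star' (h := h)
    refine induction (p := fun a => star (a + b) = star a + star b)
      (isClosed_eq (by fun_prop) (by fun_prop)) (fun a => ?_) a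
    refine induction (p := fun b => star (ofL1 h a + b) = star (ofL1 h a) + star b)
      (isClosed_eq (by fun_prop) (by fun_prop)) (fun b => ?_) b
    rw [star_ofL1, star_ofL1, ← map_add, ← map_add, star_ofL1, star_add]

instance : StarModule ℂ (CrossedProduct h) where
  star_smul c a := by
    have hc := continuous_star' (h := h)
    refine induction (p := fun a => star (c • a) = star c • star a)
      (isClosed_eq (hc.comp (continuous_const_smul c)) (hc.const_smul (star c))) (fun a => ?_) a
    calc star (c • ofL1 h a) = star (ofL1 h (c • a)) := by rw [AlgHom.map_smul_of_tower]
      _ = ofL1 h (star c • star a) := by rw [star_ofL1, star_smul]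
      _ = star c • star (ofL1 h a) := by rw [star_ofL1, AlgHom.map_smul_of_tower]

instance : CStarRing (CrossedProduct h) where
  norm_mul_self_le a := by
    have hc := continuous_star' (h := h)
    refine induction (p := fun a => ‖a‖ * ‖a‖ ≤ ‖star a * a‖)
      (isClosed_le (by fun_prop) (by fun_prop)) (fun a => ?_) a
    rw [star_ofL1, ← map_mul, norm_ofL1, norm_ofL1, envelopingNorm_star_mul_self]

instance : CStarAlgebra (CrossedProduct h) where

end CrossedProduct

end Enveloping

/-! ### The subalgebra `C₀` and the coefficient map `E₀` -/

theorem isCoeff_zero (α : EndoAction Γ A) (a : A) : IsCoeff α (0 : Γ) a := by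
  rw [isCoeff_iff, neg_zero, toCone_of_nonpos (le_refl (0 : Γ)), α.zero_apply, mul_one, one_mul]
  exact ⟨rfl, rfl⟩

theorem isCoeff_map_one (α : EndoAction Γ A) (x : PosCone Γ) : IsCoeff α (x : Γ) (α x 1) := by
  rw [isCoeff_iff, toCone_coe, toCone_of_nonpos (neg_nonpos.mpr x.2), α.zero_apply, one_mul,
    ← map_mul, one_mul]
  exact ⟨rfl, rfl⟩

namespace CrossedProduct

variable (h : FinelyRepresentable.{u, v, w} α)

/-- The canonical embedding `A → A ⋊_α Γ`, `a ↦ a δ_0`. -/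
def emb (a : A) : CrossedProduct h := ofL1 h (L1Algebra.single 0 a (isCoeff_zero α a))

/-- The element `u_x ∈ A ⋊_α Γ` corresponding to `α_x(1) δ_x`, `x ≥ 0`. -/
def u (x : PosCone Γ) : CrossedProduct h :=
  ofL1 h (L1Algebra.single (x : Γ) (α x 1) (isCoeff_map_one α x))

variable {h}

/-- `a = ∑_{x ∈ F} u_x* a_{-x} + a_0 + ∑_{x ∈ F} a_x u_x`, where `F ⊆ Γ⁺ ∖ {0}` is finite,
`a_x ∈ A α_x(1)` and `a_{-x} ∈ α_x(1) A` for `x ∈ F`. -/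
def HasExpansion (a : CrossedProduct h) (F : Finset (PosCone Γ)) (c : Γ → A) : Prop :=
  0 ∉ F ∧ (∀ x ∈ F, (∃ b, c x = b * α x 1) ∧ (∃ b, c (-x) = α x 1 * b)) ∧
    a = ∑ x ∈ F, star (u h x) * emb h (c (-x)) + emb h (c 0) + ∑ x ∈ F, emb h (c x) * u h x

variable (h) in
/-- The set `C₀` of all elements of `A ⋊_α Γ` that have such a finite expansion. -/
def C0 : Set (CrossedProduct h) := {a | ∃ F c, HasExpansion a F c}

/-- `e` is the coefficient `a_0` in some expansion of `a`. -/
def IsZeroCoeff (a : CrossedProduct h) (e : A) : Prop := ∃ F c, HasExpansion a F c ∧ c 0 = e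

open Classical in
/-- The map `E₀ : C₀ → A`, `a ↦ a_0` (set to `0` outside `C₀`). -/
def E0 (a : CrossedProduct h) : A := if ha : ∃ e, IsZeroCoeff a e then ha.choose else 0

end CrossedProduct

end

end

noncomputable section

/-! ### Twisted shifts on `ℓ²(ι, H)` -/

section DiagShift

variable {ι : Type*} [AddCommGroup ι] {H : Type*} [NormedAddCommGroup H] [InnerProductSpace ℂ H]

/-! The norm of `a` is squeezed between two estimates for the zeroth coefficient.

First, taking the zeroth coefficient is contractive for the C*-norm
(`norm_coeff_zero_le_envelopingNorm`). A fine representation on `H` is twisted by translation into a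
representation on `ℓ²(Γ, H)`, where `b_g δ_g` moves the fibre at `s` to the fibre at `s + g`.
Compressing the image of `b` to the fibre over `0` then leaves exactly `π(b_0)`. This also makes
`E₀` well defined on `C₀`, although the canonical map out of `l₁(Γ, α, A)` is not assumed injective.

Second, in the opposite direction, an element `b` with at most `N` nonzero coefficients satisfies
`‖b‖² ≤ N ‖E₀(b b*)‖` (`norm_ofL1_sq_le`). This is a Cauchy-Schwarz inequality for a sum of `N`
terms (`CStarAlgebra.norm_sum_sq_le`), together with the fact that the diagonal products of the
homogeneous parts all lie in degree `0` and add up to `E₀(b b*)`.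

Apply both to powers of `y = a a*`, and let `T` be a finite set carrying `y`. Since `Γ` is
commutative, `y ^ k` is carried by at most `(k + 1) ^ |T|` elements (`card_powSupport_le`). As `(y ^
k)(y ^ k)* = y ^ (2k)` and `‖y‖ = ‖a‖²`, this gives `‖a‖ ^ (4k) ≤ (k + 1) ^ |T| · ‖E₀(y ^ (2k))‖ ≤
(k + 1) ^ |T| · ‖a‖ ^ (4k)`. The polynomial factor disappears after taking `4k`-th roots, which is
the limit formula. -/

theorem memℓp_diagShift (g : ι) (T : H →L[ℂ] H) (f : lp (fun _ : ι => H) 2) :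
    Memℓp (E := fun _ : ι => H) (fun s => T (f (s - g))) 2 := by
  refine memℓp_gen (Summable.of_nonneg_of_le (fun s => by positivity) (fun s => ?_)
    (((Equiv.subRight g).summable_iff.mpr ((lp.memℓp f).summable (by simp))).mul_left
      (‖T‖ ^ (2 : ENNReal).toReal)))
  rw [Function.comp_apply, Equiv.subRight_apply, ← Real.mul_rpow (norm_nonneg _) (norm_nonneg _)]
  exact Real.rpow_le_rpow (norm_nonneg _) (T.le_opNorm _) (by simp)

/-- `(f, s) ↦ T (f (s - g))`. -/
def diagShiftFun (g : ι) (T : H →L[ℂ] H) (f : lp (fun _ : ι => H) 2) : lp (fun _ : ι => H) 2 :=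
  ⟨fun s => T (f (s - g)), memℓp_diagShift g T f⟩

theorem diagShiftFun_apply (g : ι) (T : H →L[ℂ] H) (f : lp (fun _ : ι => H) 2) (s : ι) :
    diagShiftFun g T f s = T (f (s - g)) := rfl

theorem norm_diagShiftFun_le (g : ι) (T : H →L[ℂ] H) (f : lp (fun _ : ι => H) 2) :
    ‖diagShiftFun g T f‖ ≤ ‖T‖ * ‖f‖ := by
  have h2 : 0 < (2 : ENNReal).toReal := by simp
  have hf : Summable fun s => ‖f (s - g)‖ ^ (2 : ENNReal).toReal :=
    (Equiv.subRight g).summable_iff.mpr ((lp.memℓp f).summable h2)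
  have hg : ∑' s, ‖f (s - g)‖ ^ (2 : ENNReal).toReal = ∑' s, ‖f s‖ ^ (2 : ENNReal).toReal :=
    (Equiv.subRight g).tsum_eq fun s => ‖f s‖ ^ (2 : ENNReal).toReal
  have hT := mul_nonneg (norm_nonneg T) (norm_nonneg f)
  refine lp.norm_le_of_tsum_le h2 hT ?_
  rw [Real.mul_rpow (norm_nonneg _) (norm_nonneg _), lp.norm_rpow_eq_tsum h2, ← hg,
    ← tsum_mul_left]
  refine Summable.tsum_le_tsum (fun s => ?_) ((lp.memℓp (diagShiftFun g T f)).summable h2)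
    (hf.mul_left _)
  rw [diagShiftFun_apply, ← Real.mul_rpow (norm_nonneg _) (norm_nonneg _)]
  exact Real.rpow_le_rpow (norm_nonneg _) (T.le_opNorm _) h2.le

/-- `(diagShift g T f)(s) = T (f (s - g))`, as a map of `T`. -/
def diagShift (g : ι) :
    (H →L[ℂ] H) →L[ℂ] (lp (fun _ : ι => H) 2 →L[ℂ] lp (fun _ : ι => H) 2) :=
  LinearMap.mkContinuous₂
    (LinearMap.mk₂ ℂ (diagShiftFun g)
      (fun _ _ _ => lp.ext rfl) (fun _ _ _ => lp.ext rfl)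
      (fun T f f' => lp.ext (funext fun s => map_add T (f (s - g)) (f' (s - g))))
      (fun c T f => lp.ext (funext fun s => map_smul T c (f (s - g)))))
    1 (fun T f => by rw [one_mul]; exact norm_diagShiftFun_le g T f)

@[simp] theorem diagShift_apply (g : ι) (T : H →L[ℂ] H) (f : lp (fun _ : ι => H) 2) (s : ι) :
    (diagShift g T f : ∀ _ : ι, H) s = T (f (s - g)) := rfl

theorem norm_diagShift_le (g : ι) (T : H →L[ℂ] H) : ‖diagShift g T‖ ≤ ‖T‖ :=
  ContinuousLinearMap.opNorm_le_bound _ (norm_nonneg _) (norm_diagShiftFun_le g T)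

/-- Translations compose additively and the operators multiply, so a family of operators that is
multiplicative with respect to the grading by `ι` stays multiplicative after the twist. -/
theorem diagShift_mul (g k : ι) (S T : H →L[ℂ] H) :
    diagShift g S * diagShift k T = diagShift (g + k) (S * T) := by
  ext f s
  simp [sub_sub]

theorem diagShift_zero_one : diagShift (0 : ι) (1 : H →L[ℂ] H) = 1 := by
  ext f s
  simp

theorem star_diagShift [CompleteSpace H] (g : ι) (T : H →L[ℂ] H) :
    star (diagShift g T) = diagShift (-g) (star T) := by
  symm
  refine (ContinuousLinearMap.eq_adjoint_iff _ _).mpr fun f f' => ?_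
  -- Translating the summation index by `g` moves the shift from one argument of the inner product
  -- to the other.
  rw [lp.inner_eq_tsum, lp.inner_eq_tsum, ← (Equiv.subRight g).tsum_eq]
  refine tsum_congr fun s => ?_
  simp [ContinuousLinearMap.star_eq_adjoint, ContinuousLinearMap.adjoint_inner_left]

end DiagShift

variable {Γ : Type u} [AddCommGroup Γ] [LinearOrder Γ] [IsOrderedAddMonoid Γ]
variable {A : Type v} [CStarAlgebra A] {α : EndoAction Γ A}

/-! ### Representations of `l₁(Γ, α, A)` from monomials -/

namespace L1Algebra

variable {h : FinelyRepresentable.{u, v, w} α} {B : Type*} [CStarAlgebra B] {M : Γ → A →L[ℂ] B}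

theorem summable_monomials (hnorm : ∀ g a, IsCoeff α g a → ‖M g a‖ ≤ ‖a‖) (b : L1Algebra h) :
    Summable fun g => ‖M g (b.coeff g)‖ :=
  Summable.of_nonneg_of_le (fun _ => norm_nonneg _) (fun g => hnorm g _ (b.isCoeff g))
    b.summable_norm

/-- Both series converge absolutely, so their product is a double series. Grouping its terms by
total degree turns it into the series of the convolution product. -/
theorem tsum_monomials_mul (hnorm : ∀ g a, IsCoeff α g a → ‖M g a‖ ≤ ‖a‖)
    (hmul : ∀ g k a b, IsCoeff α g a → IsCoeff α k b →
      M g a * M k b = M (g + k) (coeffMul h g k a b)) (a b : L1Algebra h) :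
    ∑' g, M g ((a * b).coeff g) = (∑' g, M g (a.coeff g)) * ∑' g, M g (b.coeff g) := by
  -- Absolute summability over all pairs is what permits summing degree by degree.
  have hs : Summable fun p : Γ × Γ =>
      M p.1 (coeffMul h p.2 (p.1 - p.2) (a.coeff p.2) (b.coeff (p.1 - p.2))) := by
    refine Summable.of_norm_bounded (summable_conv a b) fun p => hnorm _ _ ?_
    have := (a.isCoeff p.2).coeffMul h (b.isCoeff (p.1 - p.2))
    rwa [add_sub_cancel] at this
  rw [tsum_mul_tsum_of_summable_norm (summable_monomials hnorm a) (summable_monomials hnorm b),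
    ← (convEquiv Γ).tsum_eq]
  calc _ = ∑' g, ∑' k, M g (coeffMul h k (g - k) (a.coeff k) (b.coeff (g - k))) :=
        tsum_congr fun g => by
          rw [coeff_mul, (M g).map_tsum (summable_conv_fiber a b g)]
    _ = _ := hs.tsum_prod.symm
    _ = _ := tsum_congr fun p => by
        simp only [convEquiv, Equiv.coe_fn_mk]
        rw [hmul _ _ _ _ (a.isCoeff _) (b.isCoeff _), add_sub_cancel]

/-- The *-representation `b ↦ ∑ M_g(b_g)` of `l₁(Γ, α, A)` given by its values on monomials. -/
def lift (M : Γ → A →L[ℂ] B) (hnorm : ∀ g a, IsCoeff α g a → ‖M g a‖ ≤ ‖a‖)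
    (hmul : ∀ g k a b, IsCoeff α g a → IsCoeff α k b →
      M g a * M k b = M (g + k) (coeffMul h g k a b))
    (hone : M 0 1 = 1) (hstar : ∀ g a, star (M g a) = M (-g) (star a)) :
    L1Algebra h →⋆ₐ[ℂ] B :=
  { AlgHom.ofLinearMap
      { toFun := fun b => ∑' g, M g (b.coeff g)
        map_add' := fun a b => by
          rw [← (summable_monomials hnorm a).of_norm.tsum_add (summable_monomials hnorm b).of_norm]
          simp
        map_smul' := fun c a => by
          rw [RingHom.id_apply, ← (summable_monomials hnorm a).of_norm.tsum_const_smul c]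
          simp }
      (by
        change ∑' g, M g ((1 : L1Algebra h).coeff g) = 1
        rw [tsum_eq_single 0, coeff_one, if_pos rfl, hone]
        intro g hg
        rw [coeff_one, if_neg hg, map_zero])
      (tsum_monomials_mul hnorm hmul) with
    map_star' := fun b => by
      change ∑' g, M g ((star b).coeff g) = star (∑' g, M g (b.coeff g))
      rw [tsum_star, ← (Equiv.neg Γ).tsum_eq]
      refine tsum_congr fun g => ?_
      rw [coeff_star, hstar, Equiv.neg_apply, neg_neg] }

end L1Algebra

/-! ### The regular representation and the conditional expectation -/

namespace FineRepresentation

variable {H : Type w} [NormedAddCommGroup H] [InnerProductSpace ℂ H] [CompleteSpace H]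
  (R : FineRepresentation α H)

theorem norm_π (a : A) : ‖R.π a‖ = ‖a‖ := NonUnitalStarAlgHom.norm_map R.π R.faithful a

/-- `FineRepresentation.monomial` as a continuous linear map. -/
def monomialCLM (g : Γ) : A →L[ℂ] (H →L[ℂ] H) :=
  LinearMap.mkContinuous
    { toFun := R.monomial g
      map_add' := fun a b => by simp only [monomial, map_add, mul_add, add_mul]
      map_smul' := fun c a => by
        simp only [monomial, map_smul, mul_smul_comm, smul_mul_assoc, RingHom.id_apply] }
    (‖star (R.U (toCone (-g)))‖ * ‖R.U (toCone g)‖) (fun a => by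
      change ‖star (R.U (toCone (-g))) * R.π a * R.U (toCone g)‖ ≤ _
      calc _ ≤ ‖star (R.U (toCone (-g))) * R.π a‖ * ‖R.U (toCone g)‖ := norm_mul_le _ _
        _ ≤ ‖star (R.U (toCone (-g)))‖ * ‖R.π a‖ * ‖R.U (toCone g)‖ := by
          gcongr; exact norm_mul_le _ _
        _ = _ := by rw [norm_π]; ring)

theorem monomial_zero (a : A) : R.monomial 0 a = R.π a := by
  rw [R.monomial_of_nonneg le_rfl, toCone_of_nonpos (le_refl (0 : Γ)), R.U_zero, mul_one]

/-- The regular monomials on `ℓ²(Γ, H)`. The index type is lifted for universe reasons. -/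
def regularMonomial (g : Γ) : A →L[ℂ]
    (lp (fun _ : ULift.{v} Γ => H) 2 →L[ℂ] lp (fun _ : ULift.{v} Γ => H) 2) :=
  (diagShift (ULift.up g)).comp (R.monomialCLM g)

theorem regularMonomial_apply (g : Γ) (a : A) :
    R.regularMonomial g a = diagShift (ULift.up g) (R.monomial g a) := rfl

theorem norm_regularMonomial_le {g : Γ} {a : A} (ha : IsCoeff α g a) :
    ‖R.regularMonomial g a‖ ≤ ‖a‖ :=
  (norm_diagShift_le _ _).trans (R.norm_monomial ha).le

/-- The regular representation of `l₁(Γ, α, A)` on `ℓ²(Γ, H)`. -/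
def regular (h : FinelyRepresentable.{u, v, w} α) : L1Algebra h →⋆ₐ[ℂ]
    (lp (fun _ : ULift.{v} Γ => H) 2 →L[ℂ] lp (fun _ : ULift.{v} Γ => H) 2) :=
  L1Algebra.lift R.regularMonomial (fun _ _ ha => R.norm_regularMonomial_le ha)
    (fun g k a b ha hb => by
      simp only [regularMonomial_apply]
      rw [diagShift_mul, R.monomial_mul h ha hb]
      rfl)
    (by rw [regularMonomial_apply, monomial_zero, map_one]; exact diagShift_zero_one)
    (fun g a => by
      rw [regularMonomial_apply, regularMonomial_apply, star_diagShift, monomial_star]; rfl)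

/-- Only degree `0` maps the fibre over `0` to itself: the degree `g` term evaluates the initial
vector at `-g`, where it vanishes unless `g = 0`. -/
theorem regular_single_apply_zero {h : FinelyRepresentable.{u, v, w} α} (b : L1Algebra h) (ξ : H) :
    (R.regular h b (lp.single 2 0 ξ) : ∀ _ : ULift.{v} Γ, H) 0 = R.π (b.coeff 0) ξ := by
  have hs : Summable fun g => R.regularMonomial g (b.coeff g) :=
    (L1Algebra.summable_monomials (fun _ _ ha => R.norm_regularMonomial_le ha) b).of_norm
  -- Applying to a vector and evaluating at a point are continuous linear, so the series may be
  -- computed term by term.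
  have h1 := (hs.hasSum.mapL (ContinuousLinearMap.apply ℂ _
    (lp.single (E := fun _ : ULift.{v} Γ => H) 2 0 ξ))).mapL
      (lp.evalCLM ℂ (fun _ : ULift.{v} Γ => H) 2 0)
  have h0 : ∀ g, lp.evalCLM ℂ (fun _ : ULift.{v} Γ => H) 2 0
      (ContinuousLinearMap.apply ℂ _ (lp.single (E := fun _ : ULift.{v} Γ => H) 2 0 ξ)
        (R.regularMonomial g (b.coeff g))) =
      R.monomial g (b.coeff g)
        ((lp.single (E := fun _ : ULift.{v} Γ => H) 2 0 ξ : ∀ _ : ULift.{v} Γ, H)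
          (0 - ULift.up g)) := fun _ => rfl
  have h2 := hasSum_single (f := fun g => lp.evalCLM ℂ (fun _ : ULift.{v} Γ => H) 2 0
      (ContinuousLinearMap.apply ℂ _ (lp.single (E := fun _ : ULift.{v} Γ => H) 2 0 ξ)
        (R.regularMonomial g (b.coeff g)))) (0 : Γ) (fun g hg => by
    rw [h0, lp.single_apply_ne, map_zero]
    intro e
    rw [zero_sub, neg_eq_zero] at e
    exact hg (congrArg ULift.down e))
  refine (h1.unique h2).trans ?_
  have e : (0 : ULift.{v} Γ) - ULift.up 0 = 0 := sub_self 0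
  rw [h0, monomial_zero, e, lp.single_apply_self]

end FineRepresentation

/-- `π(b_0)` is a compression of the image of `b` in the regular representation, hence no larger in
norm. That representation is one of those over which the enveloping norm is a supremum. -/
theorem norm_coeff_zero_le_envelopingNorm {h : FinelyRepresentable.{u, v, w} α}
    (b : L1Algebra h) : ‖b.coeff 0‖ ≤ envelopingNorm h b := by
  obtain ⟨H, _, _, _, ⟨R⟩⟩ := id h
  rw [← R.norm_π]
  refine le_trans ?_ (norm_rep_le_envelopingNorm (R.regular h) b)
  refine ContinuousLinearMap.opNorm_le_bound _ (norm_nonneg _) fun ξ => ?_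
  rw [← R.regular_single_apply_zero]
  refine (lp.norm_apply_le_norm two_ne_zero _ _).trans
    ((ContinuousLinearMap.le_opNorm _ _).trans_eq ?_)
  rw [lp.norm_single (by simp)]

end

section

open scoped Pointwise

variable {Γ : Type u} [AddCommGroup Γ] [LinearOrder Γ] [IsOrderedAddMonoid Γ]
variable {A : Type v} [CStarAlgebra A] {α : EndoAction Γ A} {h : FinelyRepresentable.{u, v, w} α}

/-! ### Finitely supported elements of `l₁(Γ, α, A)` -/

namespace L1Algebra

/-- The coefficients of `b` vanish outside `S`. -/
def SupportedOn (b : L1Algebra h) (S : Finset Γ) : Prop := ∀ g ∉ S, b.coeff g = 0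

theorem SupportedOn.mono {b : L1Algebra h} {S T : Finset Γ} (hb : SupportedOn b S) (hST : S ⊆ T) :
    SupportedOn b T := fun g hg => hb g (mt (@hST g) hg)

theorem supportedOn_single (g : Γ) (a : A) (ha : IsCoeff α g a) :
    SupportedOn (single g a ha : L1Algebra h) {g} := fun k hk => by
  rw [coeff_single, if_neg (by simpa using hk)]

theorem supportedOn_zero : SupportedOn (0 : L1Algebra h) ∅ := fun _ _ => rfl

theorem supportedOn_one : SupportedOn (1 : L1Algebra h) {0} := supportedOn_single 0 1 isCoeff_one

theorem SupportedOn.add {a b : L1Algebra h} {S T : Finset Γ} (ha : SupportedOn a S)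
    (hb : SupportedOn b T) : SupportedOn (a + b) (S ∪ T) := fun g hg => by
  rw [Finset.mem_union, not_or] at hg
  rw [coeff_add, ha g hg.1, hb g hg.2, add_zero]

theorem SupportedOn.star {b : L1Algebra h} {S : Finset Γ} (hb : SupportedOn b S) :
    SupportedOn (star b) (-S) := fun g hg => by
  rw [coeff_star, hb _ (by simpa using hg), star_zero]

theorem SupportedOn.mul {a b : L1Algebra h} {S T : Finset Γ} (ha : SupportedOn a S)
    (hb : SupportedOn b T) : SupportedOn (a * b) (S + T) := fun g hg => by
  rw [coeff_mul]
  refine (tsum_congr fun k => ?_).trans tsum_zero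
  by_cases hk : k ∈ S
  · rw [hb (g - k), coeffMul_zero_right]
    intro hk'
    exact hg (Finset.mem_add.mpr ⟨k, hk, g - k, hk', add_sub_cancel _ _⟩)
  · rw [ha k hk, coeffMul_zero_left]

/-- A finset containing the support of the `n`-th power of an element supported on `S`, whose size
grows polynomially in `n`. -/
def powSupport (S : Finset Γ) (n : ℕ) : Finset Γ :=
  (Fintype.piFinset fun _ : S => Finset.range (n + 1)).image fun m => ∑ s : S, m s • (s : Γ)

/-- Each element is determined by multiplicities `m_s` in `{0, …, n}`, one for every `s` in `S`. The
order of the factors is irrelevant in an abelian group, so the count is polynomial in `n` with fixed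
exponent `|S|`. -/
theorem card_powSupport_le (S : Finset Γ) (n : ℕ) :
    (powSupport S n).card ≤ (n + 1) ^ S.card := by
  refine Finset.card_image_le.trans_eq ?_
  rw [Fintype.card_piFinset]
  simp

theorem powSupport_add_subset (S : Finset Γ) (n : ℕ) :
    powSupport S n + S ⊆ powSupport S (n + 1) := by
  intro g hg
  obtain ⟨k, hk, s, hs, rfl⟩ := Finset.mem_add.mp hg
  obtain ⟨m, hm, rfl⟩ := Finset.mem_image.mp hk
  -- Adding `s` raises its multiplicity by one, from at most `n` to at most `n + 1`.
  refine Finset.mem_image.mpr ⟨fun t => m t + if t = ⟨s, hs⟩ then 1 else 0, ?_, ?_⟩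
  · rw [Fintype.mem_piFinset] at hm ⊢
    intro t
    have := Finset.mem_range.mp (hm t)
    rw [Finset.mem_range]
    split_ifs <;> omega
  · simp [add_smul, Finset.sum_add_distrib, ite_smul]

theorem SupportedOn.pow {b : L1Algebra h} {S : Finset Γ} (hb : SupportedOn b S) (n : ℕ) :
    SupportedOn (b ^ n) (powSupport S n) := by
  induction n with
  | zero =>
    rw [pow_zero]
    refine supportedOn_one.mono (Finset.singleton_subset_iff.mpr ?_)
    exact Finset.mem_image.mpr ⟨fun _ => 0, by simp, by simp⟩
  | succ n ih =>
    rw [pow_succ]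
    exact (ih.mul hb).mono (powSupport_add_subset S n)

/-- The coefficient map as an additive homomorphism. -/
def coeffHom (g : Γ) : L1Algebra h →+ A where
  toFun b := b.coeff g
  map_zero' := coeff_zero g
  map_add' a b := coeff_add a b g

theorem coeff_sum {ι : Type*} (s : Finset ι) (f : ι → L1Algebra h) (g : Γ) :
    (∑ i ∈ s, f i).coeff g = ∑ i ∈ s, (f i).coeff g := map_sum (coeffHom g) f s

theorem coeff_sub (a b : L1Algebra h) (g : Γ) : (a - b).coeff g = a.coeff g - b.coeff g :=
  map_sub (coeffHom g) a b

theorem SupportedOn.eq_sum {b : L1Algebra h} {S : Finset Γ} (hb : SupportedOn b S) :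
    b = ∑ g ∈ S, single g (b.coeff g) (b.isCoeff g) := by
  ext k
  simp only [coeff_sum, coeff_single, Finset.sum_ite_eq]
  split_ifs with hk
  · rfl
  · exact hb k hk

theorem coeff_single_mul_single {g k : Γ} {a b : A} (ha : IsCoeff α g a) (hb : IsCoeff α k b)
    (l : Γ) : (single g a ha * single k b hb : L1Algebra h).coeff l =
      if l = g + k then coeffMul h g k a b else 0 := by
  rw [coeff_mul, tsum_eq_single g]
  · simp only [coeff_single, if_true]
    split_ifs with h1 h2 h2
    · rw [h1]
    · exact absurd (by rw [← h1, add_sub_cancel]) h2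
    · exact absurd (by rw [h2, add_sub_cancel_left]) h1
    · rw [coeffMul_zero_right]
  · intro j hj
    rw [coeff_single, if_neg hj, coeffMul_zero_left]

theorem star_single {g : Γ} {a : A} (ha : IsCoeff α g a) :
    star (single g a ha : L1Algebra h) = single (-g) (star a) ha.star_mem := by
  ext k
  simp only [coeff_star, coeff_single, neg_eq_iff_eq_neg]
  split_ifs
  · rfl
  · exact star_zero A

theorem norm_single (g : Γ) (a : A) (ha : IsCoeff α g a) :
    ‖(single g a ha : L1Algebra h)‖ = ‖a‖ := by
  rw [norm_eq, tsum_eq_single g]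
  · rw [coeff_single, if_pos rfl]
  · intro k hk
    rw [coeff_single, if_neg hk, norm_zero]

/-- A product of the parts of `b` and `b*` in degrees `k` and `-l` lands in degree `0` only when `k
= l`, so off-diagonal products do not contribute. -/
theorem SupportedOn.coeff_mul_star_zero {b : L1Algebra h} {S : Finset Γ} (hb : SupportedOn b S) :
    (b * Star.star b).coeff 0 =
      ∑ k ∈ S, coeffMul h k (-k) (b.coeff k) (Star.star (b.coeff k)) := by
  rw [coeff_mul, tsum_eq_sum (s := S)]
  · refine Finset.sum_congr rfl fun k _ => ?_
    rw [coeff_star, zero_sub, neg_neg]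
  · intro k hk
    rw [hb k hk, coeffMul_zero_left]

/-- This identifies the sum of squares in the Cauchy-Schwarz estimate with the zeroth coefficient of
`b b*`. -/
theorem SupportedOn.sum_single_mul_star {b : L1Algebra h} {S : Finset Γ} (hb : SupportedOn b S) :
    ∑ k ∈ S, single k (b.coeff k) (b.isCoeff k) * Star.star (single k (b.coeff k) (b.isCoeff k)) =
      (single 0 ((b * Star.star b).coeff 0) (isCoeff_zero α _) : L1Algebra h) := by
  ext l
  simp only [coeff_sum, star_single, coeff_single_mul_single, add_neg_cancel, coeff_single]
  split_ifs with hl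
  · exact hb.coeff_mul_star_zero.symm
  · exact Finset.sum_const_zero

end L1Algebra

theorem envelopingNorm_le_norm (b : L1Algebra h) : envelopingNorm h b ≤ ‖b‖ :=
  envelopingNorm_le (norm_nonneg b) fun _ _ _ _ ρ => L1Algebra.norm_rep_le ρ b

/-! ### Norm estimates in C*-algebras -/

/-- Cauchy-Schwarz in the C*-order: with `N` terms, `p = ∑ f_i f_i*` and `q = (∑ f_i)(∑ f_i)*`, the
positive element `∑_{i,j} (f_i - f_j)(f_i - f_j)*` equals `2Np - 2q`. Hence `0 ≤ q ≤ N p`, and the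
norm is monotone on positive elements. -/
theorem CStarAlgebra.norm_sum_sq_le {B : Type*} [CStarAlgebra B] {ι : Type*} (s : Finset ι)
    (f : ι → B) :
    ‖∑ i ∈ s, f i‖ ^ 2 ≤ s.card * ‖∑ i ∈ s, f i * star (f i)‖ := by
  let _ := CStarAlgebra.spectralOrder B
  let _ := CStarAlgebra.spectralOrderedRing B
  set q := (∑ i ∈ s, f i) * star (∑ i ∈ s, f i) with hq
  set p := ∑ i ∈ s, f i * star (f i) with hp
  have h0 : 0 ≤ ∑ i ∈ s, ∑ j ∈ s, (f i - f j) * star (f i - f j) :=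
    Finset.sum_nonneg fun i _ => Finset.sum_nonneg fun j _ => mul_star_self_nonneg _
  have h1 : ∑ i ∈ s, ∑ j ∈ s, (f i - f j) * star (f i - f j) =
      (s.card • p + s.card • p) - (q + q) := by
    have e : ∀ i j, (f i - f j) * star (f i - f j) =
        (f i * star (f i) + f j * star (f j)) - (f i * star (f j) + f j * star (f i)) :=
      fun i j => by rw [star_sub]; noncomm_ring
    simp only [e, Finset.sum_sub_distrib, Finset.sum_add_distrib, Finset.sum_const,
      ← Finset.smul_sum, ← hp]
    rw [Finset.sum_comm (f := fun i j => f j * star (f i)), hq, star_sum, Finset.sum_mul_sum]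
  rw [h1, sub_nonneg] at h0
  have hq0 : 0 ≤ q := mul_star_self_nonneg _
  have h2 := CStarAlgebra.norm_le_norm_of_nonneg_of_le (add_nonneg hq0 hq0) h0
  have e2 : ∀ x : B, ‖x + x‖ = 2 * ‖x‖ := fun x => by
    rw [← two_smul ℝ x, norm_smul]; simp
  rw [e2, e2, ← Nat.cast_smul_eq_nsmul ℝ, norm_smul, RCLike.norm_natCast] at h2
  rw [sq, ← CStarRing.norm_self_mul_star]
  linarith

/-- The C*-identity gives equality for exponents `2 ^ n`. In between, `‖x‖ ^ (2 ^ n) = ‖x ^ (2 ^ n)‖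
≤ ‖x ^ n‖ ‖x‖ ^ (2 ^ n - n)`, and the last factor cancels. The exponent `0` is excluded because `‖1‖
= 0` in the zero algebra. -/
theorem IsSelfAdjoint.le_norm_pow {B : Type*} [CStarAlgebra B] {x : B} (hx : IsSelfAdjoint x)
    (n : ℕ) (hn : n ≠ 0) : ‖x‖ ^ n ≤ ‖x ^ n‖ := by
  rcases (norm_nonneg x).eq_or_lt with h0 | h0
  · rw [← h0, zero_pow hn]
    exact norm_nonneg _
  · have hle : n ≤ 2 ^ n := Nat.lt_two_pow_self.le
    have h1 := hx.norm_pow_two_pow n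
    -- The complementary exponent `2 ^ n - n` must be positive to bound the norm of that power
    -- without assuming `‖1‖ = 1`.
    rcases hle.eq_or_lt with he | hlt
    · rw [← he] at h1
      exact h1.ge
    refine le_of_mul_le_mul_right ?_ (pow_pos h0 (2 ^ n - n))
    rw [← pow_add, Nat.add_sub_cancel' hle, ← h1]
    conv_lhs => rw [← Nat.add_sub_cancel' hle, pow_add]
    exact (norm_mul_le _ _).trans (by gcongr; exact norm_pow_le' _ (Nat.sub_pos_of_lt hlt))

theorem tendsto_nat_pow_rpow_inv (d : ℕ) :
    Tendsto (fun k : ℕ => (((k : ℝ) + 1) ^ d) ^ (-(1 / (4 * (k : ℝ))))) atTop (𝓝 1) := by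
  -- The known limit `x ^ (a / (b x + c)) → 1` is used at `x = k + 1`; the choice `b = 4`, `c = -4`
  -- makes the denominator `4k`.
  have h1 := (tendsto_rpow_div_mul_add (-(d : ℝ)) 4 (-4) (by norm_num)).comp
    (tendsto_atTop_add_const_right atTop (1 : ℝ) tendsto_natCast_atTop_atTop)
  refine h1.congr fun k => ?_
  have hk : (0 : ℝ) ≤ (k : ℝ) + 1 := by positivity
  rw [Function.comp_apply, ← Real.rpow_natCast, ← Real.rpow_mul hk]
  congr 1
  rw [show (4 : ℝ) * (k + 1) + -4 = 4 * k by ring]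
  ring

/-! ### Expansions and finitely supported elements -/

namespace CrossedProduct

open L1Algebra

/-- `x` is the image of a finitely supported element with `0`-th coefficient `e`. -/
def IsFinite (x : CrossedProduct h) (e : A) : Prop :=
  ∃ (b : L1Algebra h) (S : Finset Γ), SupportedOn b S ∧ x = ofL1 h b ∧ b.coeff 0 = e

theorem IsFinite.add {x y : CrossedProduct h} {d e : A} (hx : IsFinite x d) (hy : IsFinite y e) :
    IsFinite (x + y) (d + e) := by
  obtain ⟨a, S, hS, rfl, rfl⟩ := hx
  obtain ⟨b, T, hT, rfl, rfl⟩ := hy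
  exact ⟨a + b, S ∪ T, hS.add hT, (map_add _ _ _).symm, rfl⟩

theorem IsFinite.sum {ι : Type*} {s : Finset ι} {f : ι → CrossedProduct h}
    (hf : ∀ i ∈ s, IsFinite (f i) 0) : IsFinite (∑ i ∈ s, f i) 0 :=
  Finset.sum_induction f (IsFinite · 0) (fun x y hx hy => by simpa using hx.add hy)
    ⟨0, ∅, supportedOn_zero, (map_zero _).symm, rfl⟩ hf

/-- The coefficient condition `c α_x(1) = c` absorbs the projection contained in `u_x`. -/
theorem emb_mul_u {x : PosCone Γ} {c : A} (hc : IsCoeff α (x : Γ) c) :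
    emb h c * u h x = ofL1 h (single (x : Γ) c hc) := by
  rw [emb, u, ← map_mul]
  congr 1
  ext l
  rw [coeff_single_mul_single, coeff_single, zero_add, coeffMul, if_pos le_rfl, if_pos x.2,
    toCone_of_nonpos le_rfl, α.zero_apply]
  have := (isCoeff_iff.mp hc).1
  rw [toCone_coe] at this
  rw [this]

/-- This is the adjoint of `emb_mul_u` for `c*`. -/
theorem star_u_mul_emb {x : PosCone Γ} {c : A} (hc : IsCoeff α (-(x : Γ)) c) :
    star (u h x) * emb h c = ofL1 h (single (-(x : Γ)) c hc) := by
  have h1 := emb_mul_u (h := h) (x := x) (c := star c) (by simpa using hc.star_mem)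
  have h2 := congrArg star h1
  have h3 : star (emb h (star c)) = emb h c := by
    rw [emb, emb, star_ofL1, star_single]
    congr 1
    ext l
    simp only [coeff_single, neg_zero, star_star]
  rw [star_mul, h3, star_ofL1, star_single] at h2
  simpa only [star_star] using h2

theorem isCoeff_of_eq_mul {x : PosCone Γ} {c : A} (hc : ∃ b, c = b * α x 1) :
    IsCoeff α (x : Γ) c := by
  obtain ⟨b, rfl⟩ := hc
  rw [isCoeff_iff, toCone_coe, toCone_of_nonpos (neg_nonpos.mpr x.2), α.zero_apply, one_mul,
    mul_assoc, ← map_mul, one_mul]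
  exact ⟨rfl, rfl⟩

theorem isCoeff_of_eq_mul' {x : PosCone Γ} {c : A} (hc : ∃ b, c = α x 1 * b) :
    IsCoeff α (-(x : Γ)) c := by
  obtain ⟨b, rfl⟩ := hc
  rw [isCoeff_iff, neg_neg, toCone_coe, toCone_of_nonpos (neg_nonpos.mpr x.2), α.zero_apply,
    mul_one, ← mul_assoc, ← map_mul, one_mul]
  exact ⟨rfl, rfl⟩

theorem isFinite_single {g : Γ} {c : A} (hg : g ≠ 0) (hc : IsCoeff α g c) :
    IsFinite (ofL1 h (single g c hc)) 0 :=
  ⟨_, {g}, supportedOn_single g c hc, rfl, by rw [coeff_single, if_neg hg.symm]⟩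

/-- Since `0` is not in `F`, both sums live in nonzero degrees, and only the middle term contributes
to degree `0`. -/
theorem HasExpansion.isFinite {x : CrossedProduct h} {F : Finset (PosCone Γ)} {c : Γ → A}
    (hx : HasExpansion x F c) : IsFinite x (c 0) := by
  obtain ⟨h0, hc, rfl⟩ := hx
  have hne : ∀ x ∈ F, (x : Γ) ≠ 0 := fun x hx e => h0 (by
    rwa [show x = 0 from Subtype.ext e] at hx)
  have h1 : IsFinite (∑ x ∈ F, star (u h x) * emb h (c (-x))) 0 := IsFinite.sum fun x hx => by
    rw [star_u_mul_emb (isCoeff_of_eq_mul' (hc x hx).2)]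
    exact isFinite_single (neg_ne_zero.mpr (hne x hx)) _
  have h2 : IsFinite (∑ x ∈ F, emb h (c x) * u h x) 0 := IsFinite.sum fun x hx => by
    rw [emb_mul_u (isCoeff_of_eq_mul (hc x hx).1)]
    exact isFinite_single (hne x hx) _
  have h3 : IsFinite (emb h (c 0)) (c 0) :=
    ⟨_, {0}, supportedOn_single 0 _ (isCoeff_zero α _), rfl, by rw [coeff_single, if_pos rfl]⟩
  simpa using (h1.add h3).add h2

/-- An expansion uses one index set for both signs, so `F` collects the absolute values of the
support. Positions added by this symmetrization carry zero coefficients. -/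
theorem hasExpansion_ofL1 {b : L1Algebra h} {S : Finset Γ} (hb : SupportedOn b S) :
    HasExpansion (ofL1 h b) ((S.image fun g => toCone |g|).erase 0) b.coeff := by
  set F := (S.image fun g => toCone |g|).erase 0 with hF
  have hne : ∀ x ∈ F, (x : Γ) ≠ 0 := fun x hx e =>
    (Finset.mem_erase.mp hx).1 (Subtype.ext e)
  refine ⟨Finset.notMem_erase _ _, fun x _ => ⟨?_, ?_⟩, ?_⟩
  · simpa only [toCone_coe] using (b.isCoeff (x : Γ)).1 x.2
  · simpa only [toCone_coe, neg_neg] using (b.isCoeff (-(x : Γ))).2 (neg_nonpos.mpr x.2)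
  · have hmem : ∀ g ≠ 0, b.coeff g ≠ 0 → toCone |g| ∈ F := fun g hg hbg => by
      refine Finset.mem_erase.mpr ⟨fun e => hg ?_, Finset.mem_image_of_mem _ (not_not.mp
        (mt (hb g) hbg))⟩
      have := congrArg Subtype.val e
      rw [coe_toCone (abs_nonneg g)] at this
      exact abs_eq_zero.mp this
    -- Compared degree by degree: according to the sign of `g`, only the matching part of the
    -- expansion contributes, through the index `|g|`. If `|g|` is missing from `F`, the coefficient
    -- at `g` was already zero.
    have key : b = ∑ x ∈ F, single (-(x : Γ)) (b.coeff (-x)) (b.isCoeff _) +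
        single 0 (b.coeff 0) (b.isCoeff 0) +
        ∑ x ∈ F, single (x : Γ) (b.coeff x) (b.isCoeff _) := by
      ext g
      simp only [coeff_add, coeff_sum, coeff_single]
      rcases lt_trichotomy g 0 with hg | rfl | hg
      · have e : ((toCone |g| : PosCone Γ) : Γ) = -g := by
          rw [coe_toCone (abs_nonneg g), abs_of_neg hg]
        rw [if_neg hg.ne, Finset.sum_eq_zero (s := F) (f := fun x => if g = (x : Γ) then _ else _),
          add_zero, add_zero, Finset.sum_eq_single (toCone |g|)]
        · rw [e, neg_neg, if_pos rfl]
        · intro x _ hx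
          refine if_neg fun hgx => hx (Subtype.ext ?_)
          rw [e, hgx, neg_neg]
        · intro hx
          rw [e, neg_neg, if_pos rfl]
          exact not_not.mp (mt (hmem g hg.ne) hx)
        · exact fun x _ => if_neg (hg.trans_le x.2).ne
      · rw [if_pos rfl, Finset.sum_eq_zero, Finset.sum_eq_zero, zero_add, add_zero]
        · exact fun x hx => if_neg (hne x hx).symm
        · exact fun x hx => if_neg (neg_ne_zero.mpr (hne x hx)).symm
      · have e : ((toCone |g| : PosCone Γ) : Γ) = g := by
          rw [coe_toCone (abs_nonneg g), abs_of_pos hg]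
        rw [if_neg hg.ne', Finset.sum_eq_zero (s := F)
          (f := fun x => if g = -(x : Γ) then _ else _), zero_add, zero_add,
          Finset.sum_eq_single (toCone |g|)]
        · rw [e, if_pos rfl]
        · intro x _ hx
          refine if_neg fun hgx => hx (Subtype.ext ?_)
          rw [e, hgx]
        · intro hx
          rw [e, if_pos rfl]
          exact not_not.mp (mt (hmem g hg.ne') hx)
        · exact fun x _ => if_neg ((neg_nonpos.mpr x.2).trans_lt hg).ne'
    conv_lhs => rw [key]
    simp only [map_add, map_sum]
    congr 1
    · congr 1
      exact Finset.sum_congr rfl fun x _ => (star_u_mul_emb _).symm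
    · exact Finset.sum_congr rfl fun x _ => (emb_mul_u _).symm

/-! ### Well-definedness of `E₀` and the two norm estimates -/

theorem isZeroCoeff_iff {x : CrossedProduct h} {e : A} : IsZeroCoeff x e ↔ IsFinite x e := by
  constructor
  · rintro ⟨F, c, hx, rfl⟩
    exact hx.isFinite
  · rintro ⟨b, S, hb, rfl, rfl⟩
    exact ⟨_, _, hasExpansion_ofL1 hb, rfl⟩

theorem norm_coeff_zero_le (b : L1Algebra h) : ‖b.coeff 0‖ ≤ ‖ofL1 h b‖ := by
  rw [norm_ofL1]
  exact norm_coeff_zero_le_envelopingNorm b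

/-- Two lifts of the same element differ by something of enveloping norm zero, and contractivity
forces the zeroth coefficient of that difference to vanish. -/
theorem IsZeroCoeff.eq {x : CrossedProduct h} {d e : A} (hd : IsZeroCoeff x d)
    (he : IsZeroCoeff x e) : d = e := by
  obtain ⟨a, -, -, rfl, rfl⟩ := isZeroCoeff_iff.mp hd
  obtain ⟨b, -, -, hb, rfl⟩ := isZeroCoeff_iff.mp he
  have h1 := norm_coeff_zero_le (a - b)
  rw [map_sub, hb, sub_self, norm_zero, norm_le_zero_iff, coeff_sub, sub_eq_zero] at h1
  exact h1

theorem isZeroCoeff_ofL1 {b : L1Algebra h} {S : Finset Γ} (hb : SupportedOn b S) :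
    IsZeroCoeff (ofL1 h b) (b.coeff 0) := isZeroCoeff_iff.mpr ⟨b, S, hb, rfl, rfl⟩

theorem E0_ofL1 {b : L1Algebra h} {S : Finset Γ} (hb : SupportedOn b S) :
    E0 (ofL1 h b) = b.coeff 0 := by
  have he : ∃ e, IsZeroCoeff (ofL1 h b) e := ⟨_, isZeroCoeff_ofL1 hb⟩
  rw [E0, dif_pos he]
  exact he.choose_spec.eq (isZeroCoeff_ofL1 hb)

/-- `‖b‖² ≤ N ‖E₀(b b*)‖` if `b` is supported on a set of `N` elements. -/
theorem norm_ofL1_sq_le {b : L1Algebra h} {S : Finset Γ} (hb : SupportedOn b S) :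
    ‖ofL1 h b‖ ^ 2 ≤ S.card * ‖(b * star b).coeff 0‖ := by
  -- Cauchy-Schwarz is applied to the homogeneous parts of `b`, one for each element of `S`.
  conv_lhs => rw [hb.eq_sum, map_sum]
  refine (CStarAlgebra.norm_sum_sq_le S _).trans ?_
  simp only [star_ofL1, ← map_mul, ← map_sum]
  rw [hb.sum_single_mul_star, norm_ofL1]
  -- The sum of squares is concentrated in degree `0`, so its enveloping norm is at most its
  -- `l₁`-norm, which is the norm of that single coefficient.
  refine mul_le_mul_of_nonneg_left ((envelopingNorm_le_norm _).trans_eq ?_) (Nat.cast_nonneg _)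
  exact norm_single _ _ _

theorem existsUnique_isZeroCoeff {x : CrossedProduct h} (hx : x ∈ C0 h) (k : ℕ) :
    ∃! e : A, IsZeroCoeff ((x * star x) ^ k) e := by
  obtain ⟨F, c, hFc⟩ := hx
  obtain ⟨b, S, hb, rfl, -⟩ := hFc.isFinite
  rw [star_ofL1, ← map_mul, ← map_pow]
  exact ⟨_, isZeroCoeff_ofL1 ((hb.mul hb.star).pow k), fun e he =>
    he.eq (isZeroCoeff_ofL1 ((hb.mul hb.star).pow k))⟩

theorem tendsto_norm_E0 {x : CrossedProduct h} (ha : x ∈ C0 h) :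
    Tendsto (fun k : ℕ => ‖E0 ((x * star x) ^ (2 * k))‖ ^ (1 / (4 * (k : ℝ))))
      atTop (𝓝 ‖x‖) := by
  obtain ⟨F, c, hFc⟩ := ha
  obtain ⟨b, S, hb, rfl, -⟩ := hFc.isFinite
  have hbs := hb.mul hb.star
  have hx : ofL1 h b * star (ofL1 h b) = ofL1 h (b * star b) := by rw [star_ofL1, map_mul]
  have hsa : IsSelfAdjoint (ofL1 h (b * star b)) := by
    rw [← hx]; exact IsSelfAdjoint.mul_star_self _
  have hnorm : ‖ofL1 h (b * star b)‖ = ‖ofL1 h b‖ ^ 2 := by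
    rw [← hx, CStarRing.norm_self_mul_star, sq]
  rw [hx]
  simp only [← map_pow, fun k : ℕ => E0_ofL1 (hbs.pow (2 * k))]
  -- From here on only the finiteness of the support of `b b*` matters; `|T|` will be the degree of
  -- the polynomial factor.
  generalize hT : S + -S = T at hbs
  set y := b * star b with hy
  have hys : star y = y := by rw [hy, star_mul, star_star]
  set r := ‖ofL1 h b‖ with hr
  have hr0 : 0 ≤ r := norm_nonneg _
  have upper : ∀ k : ℕ, k ≠ 0 → ‖(y ^ (2 * k)).coeff 0‖ ≤ r ^ (4 * k) := fun k hk => by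
    refine (norm_coeff_zero_le _).trans ?_
    rw [map_pow]
    refine (norm_pow_le' _ (by omega)).trans_eq ?_
    rw [hnorm, ← pow_mul]
    congr 1
    ring
  -- The finite-support estimate is used for `y ^ k`, not `y ^ (2k)`: as `y` is self-adjoint, `(y ^
  -- k)(y ^ k)*` is `y ^ (2k)`.
  have lower : ∀ k : ℕ, k ≠ 0 →
      r ^ (4 * k) ≤ ((k : ℝ) + 1) ^ T.card * ‖(y ^ (2 * k)).coeff 0‖ := fun k hk => by
    have h1 := norm_ofL1_sq_le (hbs.pow k)
    rw [star_pow, hys, ← pow_add, ← two_mul, map_pow] at h1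
    have h2 : ‖ofL1 h y‖ ^ k ≤ ‖ofL1 h y ^ k‖ := hsa.le_norm_pow k hk
    have h3 : ((powSupport T k).card : ℝ) ≤ ((k : ℝ) + 1) ^ T.card := by
      exact_mod_cast card_powSupport_le T k
    calc r ^ (4 * k) = (‖ofL1 h y‖ ^ k) ^ 2 := by
          rw [hnorm, ← pow_mul, ← pow_mul]; congr 1; ring
      _ ≤ ‖ofL1 h y ^ k‖ ^ 2 := by gcongr
      _ ≤ _ := h1
      _ ≤ _ := by gcongr
  have hroot : ∀ k : ℕ, k ≠ 0 → (r ^ (4 * k)) ^ (1 / (4 * (k : ℝ))) = r := fun k hk => by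
    have := Real.pow_rpow_inv_natCast hr0 (n := 4 * k) (by omega)
    rw [one_div]
    exact_mod_cast this
  have hlim := (tendsto_nat_pow_rpow_inv T.card).mul_const r
  rw [one_mul] at hlim
  refine tendsto_of_tendsto_of_tendsto_of_le_of_le' hlim tendsto_const_nhds ?_ ?_
  -- At `k = 0` the exponent `1 / (4k)` is `0` by convention, so that index is discarded. For the
  -- others, the `4k`-th root of `lower` is taken and the polynomial factor is moved to the other
  -- side.
  · filter_upwards [eventually_ne_atTop 0] with k hk
    have hN : (0 : ℝ) < ((k : ℝ) + 1) ^ T.card := by positivity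
    rw [Real.rpow_neg hN.le, ← div_eq_inv_mul, div_le_iff₀ (Real.rpow_pos_of_pos hN _), mul_comm,
      ← Real.mul_rpow hN.le (norm_nonneg _)]
    calc r = (r ^ (4 * k)) ^ (1 / (4 * (k : ℝ))) := (hroot k hk).symm
      _ ≤ _ := Real.rpow_le_rpow (by positivity) (lower k hk) (by positivity)
  · filter_upwards [eventually_ne_atTop 0] with k hk
    calc _ ≤ (r ^ (4 * k)) ^ (1 / (4 * (k : ℝ))) :=
          Real.rpow_le_rpow (norm_nonneg _) (upper k hk) (by positivity)
      _ = r := hroot k hk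

end CrossedProduct

end

theorem theorem5p7 {Γ : Type u} [AddCommGroup Γ] [LinearOrder Γ] [IsOrderedAddMonoid Γ]
    {A : Type v} [CStarAlgebra A] (α : EndoAction Γ A) (h : FinelyRepresentable.{u, v, w} α)
    (a : CrossedProduct h) (ha : a ∈ CrossedProduct.C0 h) :
    (∀ k : ℕ, ∃! e : A, CrossedProduct.IsZeroCoeff ((a * star a) ^ (2 * k)) e) ∧
    Tendsto (fun k : ℕ => ‖CrossedProduct.E0 ((a * star a) ^ (2 * k))‖ ^ (1 / (4 * (k : ℝ))))
      atTop (𝓝 ‖a‖) := by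
  exact ⟨fun k => CrossedProduct.existsUnique_isZeroCoeff ha _, CrossedProduct.tendsto_norm_E0 ha⟩
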